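/- All graphs are finite and simple. For a graph $G$ write $|G|$ and $e(G)$ for its numbers of vertices and edges, $N(x)$ for the neighborhood of a vertex $x$, $d_G(u,v)$ for the distance between $u$ and $v$, and $d_G(v,X)=\min_{x\in X} d_G(v,x)$ for a nonempty set $X$ of vertices. A vertex $a$ is complete to a set $B$ of vertices if $a$ is adjacent to every vertex of $B$. An antimagic orientation of a graph $G$ with $m$ edges is a pair $(D,\tau)$, where $D$ is an orientation of $G$ and $\tau$ is a bijection from the set of arcs of $D$ onto $\{1,\dots,m\}$, such that the vertex-sums of any two distinct vertices are different; the vertex-sum of $u$ is the sum of the labels of all arcs entering $u$ minus the sum of the labels of all arcs leaving $u$. **Theorem 1.6.** Let $G$ be a connected graph and let $X=\{x_1,\dots,x_t\}\subseteq V(G)$ be a set of $t\in\{1,2,3\}$ distinct vertices such that $d_G(v,X)\le 2$ for each $v\in V(G)\setminus X$. Suppose that one of the following holds: (i) $t=1$ and $|N(x_1)|\ge 2$; or (ii) $t=2$, $e(G)\ge 2|G|-5$, and there exist distinct vertices $y_1,\dots,y_7\in V(G)\setminus X$ such that $x_1$ is complete to either $\{y_1,y_2,y_3,x_2\}$ or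 $\{y_1,y_2,y_3,y_4\}$, and $x_2$ is complete to $\{y_4,y_5,y_6,y_7\}$; or (iii) $t=3$, $e(G)\ge 2|G|-4$, and there exist distinct vertices $y_1,\dots,y_{11}\in V(G)\setminus X$ such that $x_1$ is complete to $\{y_1,y_2,y_3,y_4\}$, $x_2$ is complete to $\{y_4,y_5,y_6,y_7,y_8\}$, and $x_3$ is complete to either $\{y_4,y_9,y_{10},y_{11}\}$ or $\{y_8,y_9,y_{10},y_{11}\}$. Then $G$ admits an antimagic orientation. -/

import Mathlib

/-- `D` is an orientation of the simple graph `G`: every edge of `G` is replaced by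
exactly one of its two possible arcs, and there are no other arcs. -/
structure IsOrientation {V : Type*} (D : Digraph V) (G : SimpleGraph V) : Prop where
  adj_iff : ∀ u v : V, G.Adj u v ↔ D.Adj u v ∨ D.Adj v u
  asymm : ∀ u v : V, D.Adj u v → ¬ D.Adj v u

/-- The arc set `A(D)`; the pair `(u, v)` is the arc from `u` to `v`. -/
def arcSet {V : Type*} (D : Digraph V) : Set (V × V) :=
  {e | D.Adj e.1 e.2}

open Classical in
/-- The vertex-sum `s_{(D,τ)}(u)`: the sum of the labels of the arcs entering `u` minus the sum of
the labels of the arcs leaving `u`. It is `0` at an isolated vertex. -/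
noncomputable def vertexSum {V : Type*} [Fintype V] (D : Digraph V) (τ : V × V → ℕ) (u : V) : ℤ :=
  (∑ w : V with D.Adj w u, (τ (w, u) : ℤ)) - ∑ w : V with D.Adj u w, (τ (u, w) : ℤ)

/-- `τ` (only its values on arcs matter) is an antimagic labeling of the digraph `D` with `m` arcs:
it is a bijection from `A(D)` onto `{1, …, m}`, and distinct vertices have distinct vertex-sums. -/
structure IsAntimagicLabeling {V : Type*} [Fintype V] (D : Digraph V) (τ : V × V → ℕ) : Prop where
  bijOn : Set.BijOn τ (arcSet D) (Set.Icc 1 (arcSet D).ncard)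
  sum_ne : ∀ u v : V, u ≠ v → vertexSum D τ u ≠ vertexSum D τ v

/-- `G` admits an antimagic orientation. -/
def AdmitsAntimagicOrientation {V : Type*} [Fintype V] (G : SimpleGraph V) : Prop :=
  ∃ (D : Digraph V) (τ : V × V → ℕ), IsOrientation D G ∧ IsAntimagicLabeling D τ

/-- The vertex `a` is complete to the set `B` in `G`: it is adjacent to all vertices in `B`. -/
def IsCompleteTo {V : Type*} (G : SimpleGraph V) (a : V) (B : Set V) : Prop :=
  ∀ b ∈ B, G.Adj a b

/-! An oriented labelling is an antisymmetric flow, and vertex-sums are net inflows. Let N₁ be the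
neighbours of `X` outside `X` and N₂ the other vertices outside `X`, with sizes n₁ and n₂. Each
vertex of N₂ has a parent in N₁, each vertex of N₁ one in `X`. A few special edges get the smallest
labels and fixed directions. The remaining non-parent edges get the labels up to some M, oriented so
that they leave at every vertex an imbalance of at most M: at each vertex, edges paired by
decreasing label get opposite signs, and a two-colouring makes the choices consistent. The next n₂
labels go to the parent edges of N₂, directed to the parents, and the top n₁ labels to those of N₁,
directed away from the parents. Within each family the order follows the partial sums, so the final
sums are distinct.

Sums in N₂ now lie in [-(2M + n₂), 0) and sums in N₁ are nonnegative. A centre sends a label above M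
+ n₂ to each child and regains at most M from the balanced part. Three children therefore push it
below every vertex outside `X`; for a single centre the term M vanishes and two children suffice.

It remains to tell the centres apart. Reversing a special arc between two centres, or exchanging the
labels of their arcs to a common neighbour, moves their sums in opposite directions and leaves all
other sums alone. With three centres a pigeonhole argument applies: each pair collides in at most
one of four configurations, and there are only three pairs. The bound on e(G) makes M large enough
for this. One exceptional configuration, with two equal shifts, is first perturbed by exchanging the
labels 1 and 2. -/

/-! ### Balanced orientations -/

/-- Two involutions without fixed points can be properly two-coloured simultaneously. -/
theorem exists_bool_coloring_of_involutions {D : Type*} (α β : Equiv.Perm D)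
    (hα : ∀ d, α (α d) = d) (hβ : ∀ d, β (β d) = d)
    (hα' : ∀ d, α d ≠ d) (hβ' : ∀ d, β d ≠ d) :
    ∃ c : D → Bool, ∀ d, c (α d) = !c d ∧ c (β d) = !c d := by
  classical
  set σ : Equiv.Perm D := α * β with hσ
  have hαα : α * α = 1 := by ext d; simp [hα]
  have hββ : β * β = 1 := by ext d; simp [hβ]
  have hα1 : α⁻¹ = α := inv_eq_of_mul_eq_one_right hαα
  have hβ1 : β⁻¹ = β := inv_eq_of_mul_eq_one_right hββ
  have hconj : α * σ * α⁻¹ = σ⁻¹ := by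
    rw [hσ, mul_inv_rev, hα1, hβ1, ← mul_assoc, hαα, one_mul]
  have hpow : ∀ (k : ℤ) (d : D), α ((σ ^ k) d) = (σ ^ (-k)) (α d) := by
    intro k d
    have h : α * σ ^ k * α⁻¹ = σ ^ (-k) := by
      rw [← conj_zpow, hconj, inv_zpow, zpow_neg]
    have h' : α * σ ^ k = σ ^ (-k) * α := by rw [← h]; group
    exact congrArg (fun e : Equiv.Perm D => e d) h'
  have hβσ : ∀ d, β d = α (σ d) := by intro d; simp [hσ, hα]
  -- If α d = σ^k d, then σ^j d is fixed by α when k = 2j and by β when k = 2j + 1.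
  have hne : ∀ d, ¬ σ.SameCycle d (α d) := by
    rintro d ⟨k, hk⟩
    rcases Int.even_or_odd' k with ⟨j, rfl | rfl⟩
    · apply hα' ((σ ^ j) d)
      rw [hpow, ← hk, ← Equiv.Perm.mul_apply, ← zpow_add]
      congr 2; ring
    · apply hβ' ((σ ^ j) d)
      have h1 : σ ((σ ^ j) d) = (σ ^ (j + 1)) d := by
        rw [add_comm, zpow_add, zpow_one]; rfl
      rw [hβσ, h1, hpow, ← hk, ← Equiv.Perm.mul_apply, ← zpow_add]
      congr 2; ring
  let S := Equiv.Perm.SameCycle.setoid σ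
  let q : D → Quotient S := fun d => Quotient.mk S d
  have hq : ∀ a b, q a = q b ↔ σ.SameCycle a b := fun a b => Quotient.eq (r := S)
  -- Both α and β carry the cycle of d to that of α d, a different one. Any linear order on the
  -- cycles singles out one cycle of each such pair.
  let _ : LinearOrder (Quotient S) := linearOrderOfSTO WellOrderingRel
  refine ⟨fun d => decide (q d < q (α d)), fun d => ?_⟩
  have h1 : q d ≠ q (α d) := fun h => hne d ((hq _ _).1 h)
  have h2 : q (β d) = q (α d) := by
    rw [hq, hβσ]
    refine ⟨1, ?_⟩
    have := hpow 1 d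
    rw [zpow_one] at this
    rw [this, ← Equiv.Perm.mul_apply, ← zpow_add]
    simp
  have h3 : q (α (β d)) = q d := by
    rw [hq]
    refine ⟨-1, ?_⟩
    change (σ ^ (-1 : ℤ)) (σ d) = d
    simp
  have key : (decide (q (α d) < q d)) = !decide (q d < q (α d)) := by
    rcases lt_or_gt_of_ne h1 with h | h
    · simp [h, h.le]
    · simp [h, h.le]
  refine ⟨?_, ?_⟩
  · simp only [hα]; exact key
  · simp only [h2, h3]; exact key

/-- Fixed points of β disappear on the double D × Bool, where the second map exchanges the two
sheets above them. The colouring is then read on one sheet. -/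
theorem exists_bool_coloring_of_involutions' {D : Type*} (α β : D → D)
    (hα : ∀ d, α (α d) = d) (hβ : ∀ d, β (β d) = d) (hα' : ∀ d, α d ≠ d) :
    ∃ c : D → Bool, ∀ d, c (α d) = !c d ∧ (β d ≠ d → c (β d) = !c d) := by
  classical
  let A : D × Bool → D × Bool := fun d => (α d.1, d.2)
  let B : D × Bool → D × Bool := fun d => if β d.1 = d.1 then (d.1, !d.2) else (β d.1, d.2)
  have hA : Function.Involutive A := fun d => by simp [A, hα]
  have hB : Function.Involutive B := fun d => by
    by_cases h : β d.1 = d.1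
    · simp [B, h]
    · have : ¬ β (β d.1) = β d.1 := by rw [hβ]; exact fun h' => h h'.symm
      simp [B, h, hβ, Ne.symm h]
  obtain ⟨c, hc⟩ := exists_bool_coloring_of_involutions hA.toPerm hB.toPerm
    (fun d => hA d) (fun d => hB d)
    (fun d h => hα' d.1 (congrArg Prod.fst h))
    (fun d h => by
      have h' : B d = d := h
      by_cases hd : β d.1 = d.1
      · simp only [B, hd, if_true] at h'
        have := congrArg Prod.snd h'
        simp at this
      · simp only [B, hd, if_false] at h'
        exact hd (congrArg Prod.fst h'))
  refine ⟨fun d => c (d, false), fun d => ⟨(hc (d, false)).1, fun h => ?_⟩⟩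
  have := (hc (d, false)).2
  simpa [Function.Involutive.toPerm, B, h] using this

/-- Pairing the elements of a weighted finite set in order of decreasing weight: opposite signs on
pairs leave a signed sum bounded by the maximal weight. -/
theorem exists_pairing {V : Type*} [DecidableEq V] (ω : V → ℕ) (A : Finset V) :
    ∃ β : V → V, (∀ a, β (β a) = a) ∧ (∀ a ∈ A, β a ∈ A) ∧ (∀ a ∉ A, β a = a) ∧
      ∀ (W : ℕ) (σ : V → ℤ), (∀ a ∈ A, ω a ≤ W) → (∀ a ∈ A, σ a = 1 ∨ σ a = -1) →
        (∀ a ∈ A, β a ≠ a → σ (β a) = -σ a) → |∑ a ∈ A, σ a * ω a| ≤ W := by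
  induction A using Finset.strongInduction with
  | H A ih =>
  rcases A.eq_empty_or_nonempty with rfl | hA
  · exact ⟨id, by simp⟩
  obtain ⟨a, ha, hmax⟩ := A.exists_max_image ω hA
  rcases (A.erase a).eq_empty_or_nonempty with hA' | hA'
  · have hAa : A = {a} := by
      rw [← Finset.insert_erase ha, hA']; rfl
    subst hAa
    refine ⟨id, by simp, by simp, by simp, fun W σ hW hσ _ => ?_⟩
    have h1 := hW a (by simp)
    rcases hσ a (by simp) with h | h <;> simp [h, h1]
  obtain ⟨b, hb, hbmax⟩ := (A.erase a).exists_max_image ω hA'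
  set B := (A.erase a).erase b with hB
  have hBA : B ⊂ A := (Finset.erase_ssubset hb).trans (Finset.erase_ssubset ha)
  obtain ⟨β, hββ, hβB, hβn, hsum⟩ := ih B hBA
  have hab : a ≠ b := (Finset.ne_of_mem_erase hb).symm
  have hbA : b ∈ A := Finset.mem_of_mem_erase hb
  have haB : a ∉ B := by simp [hB]
  have hbB : b ∉ B := by simp [hB]
  have hβa : β a = a := hβn a haB
  have hβb : β b = b := hβn b hbB
  have hBmem : ∀ v, v ∈ B ↔ v ≠ b ∧ v ≠ a ∧ v ∈ A := by intro v; simp [hB]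
  have hne : ∀ v, v ≠ a → v ≠ b → β v ≠ a ∧ β v ≠ b := by
    intro v hva hvb
    constructor
    · intro h; apply hva; rw [← hββ v, h, hβa]
    · intro h; apply hvb; rw [← hββ v, h, hβb]
  refine ⟨fun v => if v = a then b else if v = b then a else β v, ?_, ?_, ?_, ?_⟩
  · intro v
    by_cases hva : v = a
    · subst hva; simp [hab.symm]
    by_cases hvb : v = b
    · subst hvb; simp [hva]
    simp [hva, hvb, hne v hva hvb, hββ]
  · intro v hv
    by_cases hva : v = a
    · simp [hva, hbA]
    by_cases hvb : v = b
    · simp [hvb, hab.symm, ha]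
    simp only [hva, hvb, if_false]
    exact hBA.1 (hβB v ((hBmem v).2 ⟨hvb, hva, hv⟩))
  · intro v hv
    have hva : v ≠ a := by rintro rfl; exact hv ha
    have hvb : v ≠ b := by rintro rfl; exact hv hbA
    simp only [hva, hvb, if_false]
    exact hβn v fun h => hv (hBA.1 h)
  · intro W σ hW hσ hopp
    -- The rest is bounded by ω b, not merely by W. The heaviest pair adds ±(ω a - ω b), so the
    -- total stays within ω a.
    have h1 := hsum (ω b) σ (fun v hv => hbmax v (Finset.mem_of_mem_erase hv))
      (fun v hv => hσ v (hBA.1 hv)) (fun v hv hne' => by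
        obtain ⟨hvb, hva, hvA⟩ := (hBmem v).1 hv
        have := hopp v hvA
        simp only [hva, hvb, if_false] at this
        exact this hne')
    have h2 : σ b = -σ a := by
      have := hopp a ha
      simpa [hab.symm] using this
    have h3 : ∑ v ∈ A, σ v * ω v = σ a * ω a + (σ b * ω b + ∑ v ∈ B, σ v * ω v) := by
      rw [hB, Finset.add_sum_erase _ (fun v => σ v * (ω v : ℤ)) hb,
        Finset.add_sum_erase _ (fun v => σ v * (ω v : ℤ)) ha]
    have h4 : (ω b : ℤ) ≤ ω a := by exact_mod_cast hmax b hbA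
    have h5 : (ω a : ℤ) ≤ W := by exact_mod_cast hW a ha
    rw [h3, h2]
    rw [abs_le] at h1 ⊢
    rcases hσ a ha with h | h <;> rw [h] <;> constructor <;> linarith [h1.1, h1.2]

/-- Every graph whose edges carry weights at most `W` has an orientation in which every vertex has
imbalance at most `W`. -/
theorem exists_balanced_orientation {V : Type*} [Fintype V] [DecidableEq V] (H : SimpleGraph V)
    [DecidableRel H.Adj] (L : Sym2 V → ℕ) (W : ℕ) (hL : ∀ e ∈ H.edgeSet, L e ≤ W) :
    ∃ σ : V → V → ℤ, (∀ u v, σ u v = -σ v u) ∧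
      (∀ u v, H.Adj u v → σ u v = 1 ∨ σ u v = -1) ∧ (∀ u v, ¬ H.Adj u v → σ u v = 0) ∧
      ∀ u, |∑ w, σ w u * L s(w, u)| ≤ W := by
  choose β hββ hβA hβn hβ using fun u : V => exists_pairing (fun w => L s(w, u)) (H.neighborFinset u)
  let D := {d : V × V // H.Adj d.1 d.2}
  -- Reversal `a` changing the colour makes the signs antisymmetric; passing to the partner `b` at
  -- the first endpoint changing it gives paired edges opposite signs.
  let a : D → D := fun d => ⟨(d.1.2, d.1.1), d.2.symm⟩
  let b : D → D := fun d => ⟨(d.1.1, β d.1.1 d.1.2), by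
    have := hβA d.1.1 d.1.2 (by simpa using d.2)
    simpa using this⟩
  obtain ⟨c, hc⟩ := exists_bool_coloring_of_involutions' a b (fun d => rfl)
    (fun d => Subtype.ext (Prod.ext rfl (hββ _ _)))
    (fun d h => d.2.ne (congrArg Prod.snd (congrArg Subtype.val h)))
  let σ : V → V → ℤ := fun w u => if h : H.Adj u w then (if c ⟨(u, w), h⟩ then 1 else -1) else 0
  have hσ1 : ∀ u v, H.Adj u v → σ u v = 1 ∨ σ u v = -1 := by
    intro u v h
    simp only [σ, h.symm, dite_true]
    split_ifs <;> simp
  refine ⟨σ, ?_, hσ1, ?_, ?_⟩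
  · intro u v
    by_cases h : H.Adj u v
    · have := (hc ⟨(u, v), h⟩).1
      simp only [a] at this
      simp only [σ, h, h.symm, dite_true, this]
      cases c ⟨(u, v), h⟩ <;> simp
    · have h' : ¬ H.Adj v u := fun h' => h h'.symm
      simp [σ, h, h']
  · intro u v h
    have h' : ¬ H.Adj v u := fun h' => h h'.symm
    simp [σ, h']
  · intro u
    have h1 : ∑ w, σ w u * (L s(w, u) : ℤ) = ∑ w ∈ H.neighborFinset u, σ w u * (L s(w, u) : ℤ) := by
      symm
      apply Finset.sum_subset (Finset.subset_univ _)
      intro w _ hw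
      have : ¬ H.Adj u w := by simpa using hw
      simp [σ, this]
    rw [h1]
    apply hβ u W (fun w => σ w u)
    · intro w hw
      apply hL
      simpa [H.adj_comm] using hw
    · intro w hw
      apply hσ1
      simpa [H.adj_comm] using hw
    · intro w hw hne
      have h : H.Adj u w := by simpa using hw
      have h' : H.Adj u (β u w) := by simpa using hβA u w hw
      have := (hc ⟨(u, w), h⟩).2 (fun h'' => hne (congrArg Prod.snd (congrArg Subtype.val h'')))
      simp only [b] at this
      simp only [σ, h, h', dite_true, this]
      cases c ⟨(u, w), h⟩ <;> simp

/-! ### Signed labellings and local changes -/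

/-- `f` encodes an oriented labelling of `G`: `f u v` is the label of the edge `uv` if it is oriented
from `u` to `v`, and minus the label if it is oriented from `v` to `u`. The labels are exactly the
numbers in `(lo, hi]`, each used once. -/
structure IsSignedLabeling {V : Type*} (G : SimpleGraph V) (lo hi : ℕ) (f : V → V → ℤ) : Prop where
  anti : ∀ u v, f u v = -f v u
  supp : ∀ u v, ¬ G.Adj u v → f u v = 0
  range : ∀ u v, G.Adj u v → lo < |f u v| ∧ |f u v| ≤ hi
  inj : ∀ u v u' v', G.Adj u v → G.Adj u' v' → |f u v| = |f u' v'| → s(u, v) = s(u', v')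
  surj : ∀ l : ℕ, lo < l → l ≤ hi → ∃ u v, G.Adj u v ∧ |f u v| = l

/-- The net amount flowing into the vertex `u`. -/
def inflow {V : Type*} [Fintype V] (f : V → V → ℤ) (u : V) : ℤ := ∑ w, f w u

theorem inflow_add {V : Type*} [Fintype V] (f g : V → V → ℤ) (u : V) :
    inflow (f + g) u = inflow f u + inflow g u := by
  simp [inflow, Finset.sum_add_distrib]

theorem IsSignedLabeling.ne_zero {V : Type*} {G : SimpleGraph V} {lo hi : ℕ} {f : V → V → ℤ}
    (h : IsSignedLabeling G lo hi f) {u v : V} (huv : G.Adj u v) : f u v ≠ 0 := by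
  intro h0
  have := (h.range u v huv).1
  rw [h0] at this
  simp at this
  omega

/-- This permits labelling layer by layer: the layers are edge-disjoint and their label ranges abut.
-/
theorem IsSignedLabeling.sup {V : Type*} {G H : SimpleGraph V} {a b c : ℕ} {f g : V → V → ℤ}
    (hf : IsSignedLabeling G a b f) (hg : IsSignedLabeling H b c g) (hab : a ≤ b) (hbc : b ≤ c)
    (hd : ∀ u v, G.Adj u v → ¬ H.Adj u v) : IsSignedLabeling (G ⊔ H) a c (f + g) := by
  have h1 : ∀ u v, G.Adj u v → (f + g) u v = f u v := fun u v h => by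
    simp [hg.supp u v (hd u v h)]
  have h2 : ∀ u v, H.Adj u v → (f + g) u v = g u v := fun u v h => by
    simp [hf.supp u v (fun h' => hd u v h' h)]
  constructor
  · intro u v
    simp only [Pi.add_apply]
    rw [hf.anti u v, hg.anti u v]; ring
  · intro u v h
    rw [SimpleGraph.sup_adj, not_or] at h
    simp [hf.supp u v h.1, hg.supp u v h.2]
  · rintro u v (h | h)
    · rw [h1 u v h]
      have := hf.range u v h
      omega
    · rw [h2 u v h]
      have := hg.range u v h
      omega
  · rintro u v u' v' (h | h) (h' | h')
    · rw [h1 u v h, h1 u' v' h']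
      exact hf.inj u v u' v' h h'
    · rw [h1 u v h, h2 u' v' h']
      intro he
      have := hf.range u v h
      have := hg.range u' v' h'
      omega
    · rw [h2 u v h, h1 u' v' h']
      intro he
      have := hg.range u v h
      have := hf.range u' v' h'
      omega
    · rw [h2 u v h, h2 u' v' h']
      exact hg.inj u v u' v' h h'
  · intro l hl hl'
    by_cases h : l ≤ b
    · obtain ⟨u, v, huv, hl⟩ := hf.surj l hl h
      exact ⟨u, v, Or.inl huv, by rw [h1 u v huv, hl]⟩
    · obtain ⟨u, v, huv, hl⟩ := hg.surj l (by omega) hl'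
      exact ⟨u, v, Or.inr huv, by rw [h2 u v huv, hl]⟩

/-- Permuting the darts of `G`, compatibly with reversal, permutes a signed labelling. -/
theorem IsSignedLabeling.comp {V : Type*} {G : SimpleGraph V} {lo hi : ℕ} {f : V → V → ℤ}
    (h : IsSignedLabeling G lo hi f) (e : Equiv.Perm (V × V))
    (he : ∀ d, e d.swap = (e d).swap) (hadj : ∀ d, G.Adj (e d).1 (e d).2 ↔ G.Adj d.1 d.2) :
    IsSignedLabeling G lo hi (fun u v => f (e (u, v)).1 (e (u, v)).2) := by
  constructor
  · intro u v
    have := he (u, v)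
    simp only [Prod.swap_prod_mk] at this
    rw [this]
    exact h.anti _ _
  · intro u v huv
    exact h.supp _ _ fun h' => huv ((hadj (u, v)).1 h')
  · intro u v huv
    exact h.range _ _ ((hadj (u, v)).2 huv)
  · intro u v u' v' huv huv' heq
    have h1 := h.inj _ _ _ _ ((hadj (u, v)).2 huv) ((hadj (u', v')).2 huv') heq
    rcases Sym2.mk_eq_mk_iff.1 h1 with h2 | h2
    · have h3 : (u, v) = (u', v') := e.injective (by simpa using h2)
      rw [Prod.mk.injEq] at h3
      rw [h3.1, h3.2]
    · have h2' : e (u, v) = (e (u', v')).swap := by simpa using h2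
      rw [← he] at h2'
      have := e.injective h2'
      simp only [Prod.swap_prod_mk, Prod.mk.injEq] at this
      rw [this.1, this.2, Sym2.eq_swap]
  · intro l hl hl'
    obtain ⟨u, v, huv, h1⟩ := h.surj l hl hl'
    refine ⟨(e.symm (u, v)).1, (e.symm (u, v)).2, ?_, ?_⟩
    · rw [← hadj]; simpa using huv
    · simpa using h1

/-- Signed values are exchanged, so directions move along with labels. When b = d the two changes at
this common endpoint cancel, and only a and c are affected. -/
theorem IsSignedLabeling.exists_swap {V : Type*} [Fintype V] [DecidableEq V] {G : SimpleGraph V}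
    {lo hi : ℕ} {f : V → V → ℤ} (h : IsSignedLabeling G lo hi f) {a b c d : V}
    (hab : G.Adj a b) (hcd : G.Adj c d) (hne : s(a, b) ≠ s(c, d)) :
    ∃ f', IsSignedLabeling G lo hi f' ∧
      (∀ u v, s(u, v) ≠ s(a, b) → s(u, v) ≠ s(c, d) → f' u v = f u v) ∧
      f' a b = f c d ∧ f' c d = f a b ∧
      ∀ w, inflow f' w = inflow f w + (f c d - f a b) *
        ((if w = b then 1 else 0) - (if w = a then 1 else 0)
          - (if w = d then 1 else 0) + (if w = c then 1 else 0)) := by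
  have hne' := hne
  rw [Ne, Sym2.eq_iff] at hne'
  have hab' := hab.ne
  have hcd' := hcd.ne
  let e0 : V × V → V × V := fun x => if x = (a, b) then (c, d) else if x = (b, a) then (d, c)
    else if x = (c, d) then (a, b) else if x = (d, c) then (b, a) else x
  have e1 : e0 (a, b) = (c, d) := by simp [e0]
  have e2 : e0 (b, a) = (d, c) := by simp [e0, hab']
  have e3 : e0 (c, d) = (a, b) := by simp only [e0, Prod.mk.injEq]; grind
  have e4 : e0 (d, c) = (b, a) := by simp only [e0, Prod.mk.injEq]; grind
  have e5 : ∀ x, x ≠ (a, b) → x ≠ (b, a) → x ≠ (c, d) → x ≠ (d, c) → e0 x = x := by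
    intro x h1 h2 h3 h4
    simp [e0, h1, h2, h3, h4]
  have hcases : ∀ x, x = (a, b) ∨ x = (b, a) ∨ x = (c, d) ∨ x = (d, c) ∨
      (x ≠ (a, b) ∧ x ≠ (b, a) ∧ x ≠ (c, d) ∧ x ≠ (d, c)) := by
    intro x; tauto
  have he0 : Function.Involutive e0 := by
    intro x
    rcases hcases x with rfl | rfl | rfl | rfl | ⟨h1, h2, h3, h4⟩
    · rw [e1, e3]
    · rw [e2, e4]
    · rw [e3, e1]
    · rw [e4, e2]
    · rw [e5 x h1 h2 h3 h4, e5 x h1 h2 h3 h4]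
  have hadj : ∀ x, G.Adj (e0 x).1 (e0 x).2 ↔ G.Adj x.1 x.2 := by
    intro x
    rcases hcases x with rfl | rfl | rfl | rfl | ⟨h1, h2, h3, h4⟩
    · simp [e1, hab, hcd]
    · simp [e2, hab.symm, hcd.symm]
    · simp [e3, hab, hcd]
    · simp [e4, hab.symm, hcd.symm]
    · rw [e5 x h1 h2 h3 h4]
  have hsw : ∀ x, e0 x.swap = (e0 x).swap := by
    intro x
    rcases hcases x with rfl | rfl | rfl | rfl | ⟨h1, h2, h3, h4⟩
    · rw [e1, Prod.swap_prod_mk, e2, Prod.swap_prod_mk]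
    · rw [e2, Prod.swap_prod_mk, e1, Prod.swap_prod_mk]
    · rw [e3, Prod.swap_prod_mk, e4, Prod.swap_prod_mk]
    · rw [e4, Prod.swap_prod_mk, e3, Prod.swap_prod_mk]
    · obtain ⟨u, v⟩ := x
      rw [e5 _ h1 h2 h3 h4]
      apply e5 <;> · simp only [Prod.swap_prod_mk, ne_eq, Prod.mk.injEq] at *; tauto
  have hf' := h.comp he0.toPerm hsw hadj
  refine ⟨_, hf', ?_, by simp [e1], by simp [e3], ?_⟩
  · intro u v h1 h2
    rw [Ne, Sym2.eq_iff] at h1 h2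
    have : e0 (u, v) = (u, v) := by
      simp only [e0, Prod.mk.injEq]
      grind
    simp [this]
  · intro w
    have key : ∀ u, f (e0 (u, w)).1 (e0 (u, w)).2 = f u w + (f c d - f a b) *
        ((if u = a then (if w = b then 1 else 0) else 0) -
          (if u = b then (if w = a then 1 else 0) else 0)
          - (if u = c then (if w = d then 1 else 0) else 0)
          + (if u = d then (if w = c then 1 else 0) else 0)) := by
      intro u
      have h1 := h.anti b a
      have h2 := h.anti d c
      simp only [e0, Prod.mk.injEq]
      grind
    simp only [inflow, Function.Involutive.coe_toPerm, key, Finset.sum_add_distrib, ← Finset.mul_sum,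
      Finset.sum_sub_distrib, Finset.sum_ite_eq', Finset.mem_univ, if_true]

theorem IsSignedLabeling.exists_flip {V : Type*} [Fintype V] [DecidableEq V] {G : SimpleGraph V}
    {lo hi : ℕ} {f : V → V → ℤ} (h : IsSignedLabeling G lo hi f) {a b : V} (hab : G.Adj a b) :
    ∃ f', IsSignedLabeling G lo hi f' ∧
      ∀ w, inflow f' w = inflow f w + 2 * f a b *
        ((if w = a then 1 else 0) - (if w = b then 1 else 0)) := by
  have hab' := hab.ne
  let e0 : V × V → V × V := fun x => if x = (a, b) then (b, a) else if x = (b, a) then (a, b) else x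
  have he0 : Function.Involutive e0 := by
    rintro ⟨u, v⟩
    simp only [e0, Prod.mk.injEq]
    grind
  have hadj : ∀ x, G.Adj (e0 x).1 (e0 x).2 ↔ G.Adj x.1 x.2 := by
    rintro ⟨u, v⟩
    have h1 := hab.symm
    simp only [e0, Prod.mk.injEq]
    grind
  have hsw : ∀ x, e0 x.swap = (e0 x).swap := by
    rintro ⟨u, v⟩
    simp only [e0, Prod.mk.injEq, Prod.swap_prod_mk]
    grind [Prod.swap_prod_mk]
  refine ⟨_, h.comp he0.toPerm hsw hadj, fun w => ?_⟩
  have key : ∀ u, f (e0 (u, w)).1 (e0 (u, w)).2 = f u w + 2 * f a b *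
      ((if u = b then (if w = a then 1 else 0) else 0) -
        (if u = a then (if w = b then 1 else 0) else 0)) := by
    intro u
    have h1 := h.anti b a
    simp only [e0, Prod.mk.injEq]
    grind
  simp only [inflow, Function.Involutive.coe_toPerm, key, Finset.sum_add_distrib, ← Finset.mul_sum,
    Finset.sum_sub_distrib, Finset.sum_ite_eq', Finset.mem_univ, if_true]

/-! ### Parent edges and sorted labels -/

/-- The graph joining every vertex of `S` to its parent. -/
def parentGraph {V : Type*} (S : Finset V) (par : V → V) : SimpleGraph V :=
  SimpleGraph.fromRel fun u v => u ∈ S ∧ v = par u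

/-- The flow sending `c v` from the parent of `v` to `v`, for every `v` in `S`. -/
def parentFlow {V : Type*} [DecidableEq V] (S : Finset V) (par : V → V) (c : V → ℤ) (u v : V) : ℤ :=
  (if v ∈ S ∧ u = par v then c v else 0) - (if u ∈ S ∧ v = par u then c u else 0)

theorem inflow_parentFlow {V : Type*} [Fintype V] [DecidableEq V] (S : Finset V) (par : V → V)
    (c : V → ℤ) (u : V) :
    inflow (parentFlow S par c) u =
      (if u ∈ S then c u else 0) - ∑ v ∈ S with par v = u, c v := by
  unfold inflow parentFlow
  rw [Finset.sum_sub_distrib]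
  congr 1
  · by_cases h : u ∈ S <;> simp [h]
  · rw [← Finset.sum_filter]
    apply Finset.sum_congr _ (fun _ _ => rfl)
    ext w
    simp [eq_comm]

theorem parentGraph_adj {V : Type*} {S : Finset V} {par : V → V} (hpar : ∀ v ∈ S, par v ∉ S)
    {u v : V} : (parentGraph S par).Adj u v ↔ (u ∈ S ∧ v = par u) ∨ (v ∈ S ∧ u = par v) := by
  rw [parentGraph, SimpleGraph.fromRel_adj]
  refine ⟨fun h => h.2, fun h => ⟨?_, h⟩⟩
  rintro rfl
  rcases h with ⟨h1, h2⟩ | ⟨h1, h2⟩ <;> exact hpar u h1 (h2 ▸ h1)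

theorem parentFlow_parent {V : Type*} [DecidableEq V] {S : Finset V} {par : V → V}
    (hpar : ∀ v ∈ S, par v ∉ S) (c : V → ℤ) {v : V} (hv : v ∈ S) :
    parentFlow S par c (par v) v = c v := by
  simp [parentFlow, hv, hpar v hv]

/-- As no parent lies in `S`, each edge has exactly one endpoint in `S`, so labelling vertices of
`S` amounts to labelling edges. -/
theorem isSignedLabeling_parentFlow {V : Type*} [DecidableEq V] {S : Finset V} {par : V → V}
    (hpar : ∀ v ∈ S, par v ∉ S) {c : V → ℤ} {lo hi : ℕ}
    (hc : Set.BijOn (fun v => (c v).natAbs) S (Set.Ioc lo hi)) :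
    IsSignedLabeling (parentGraph S par) lo hi (parentFlow S par c) := by
  have hanti : ∀ u v, parentFlow S par c u v = -parentFlow S par c v u := by
    intro u v; simp [parentFlow]
  have h1 : ∀ v ∈ S, |parentFlow S par c (par v) v| = (c v).natAbs := by
    intro v hv; rw [parentFlow_parent hpar c hv, Int.natCast_natAbs]
  have h2 : ∀ u v, (parentGraph S par).Adj u v → ∃ w ∈ S, s(u, v) = s(w, par w) ∧
      |parentFlow S par c u v| = (c w).natAbs := by
    intro u v huv
    rcases (parentGraph_adj hpar).1 huv with ⟨hu, rfl⟩ | ⟨hv, rfl⟩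
    · exact ⟨u, hu, rfl, by rw [hanti, abs_neg, h1 u hu]⟩
    · exact ⟨v, hv, Sym2.eq_swap, h1 v hv⟩
  constructor
  · exact hanti
  · intro u v huv
    rw [parentGraph_adj hpar, not_or] at huv
    simp [parentFlow, huv.1, huv.2]
  · intro u v huv
    obtain ⟨w, hw, -, h3⟩ := h2 u v huv
    have := hc.mapsTo hw
    simp only [Set.mem_Ioc] at this
    omega
  · intro u v u' v' huv huv' heq
    obtain ⟨w, hw, h3, h4⟩ := h2 u v huv
    obtain ⟨w', hw', h3', h4'⟩ := h2 u' v' huv'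
    have : w = w' := hc.injOn hw hw' (show (c w).natAbs = (c w').natAbs by omega)
    rw [h3, h3', this]
  · intro l hl hl'
    obtain ⟨w, hw, h3⟩ := hc.surjOn ⟨hl, hl'⟩
    simp only at h3
    exact ⟨par w, w, (parentGraph_adj hpar).2 (Or.inr ⟨hw, rfl⟩), by rw [h1 w hw, h3]⟩

/-- The labels in `(lo, lo + |S|]` can be assigned to `S` in the order of given values `q`. -/
theorem exists_sorted_labels {V : Type*} [DecidableEq V] (S : Finset V) (q : V → ℤ) (lo : ℕ) :
    ∃ b : V → ℕ, Set.BijOn b S (Set.Ioc lo (lo + S.card)) ∧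
      ∀ u ∈ S, ∀ v ∈ S, b u < b v → q u ≤ q v := by
  induction S using Finset.strongInduction with
  | H S ih =>
  rcases S.eq_empty_or_nonempty with rfl | hS
  · exact ⟨fun _ => 0, by simp, by simp⟩
  obtain ⟨a, ha, hmax⟩ := S.exists_max_image q hS
  obtain ⟨b, hb, hbq⟩ := ih (S.erase a) (Finset.erase_ssubset ha)
  have hcard := Finset.card_erase_add_one ha
  have hmem : ∀ v ∈ S, v ≠ a → lo < b v ∧ b v < lo + S.card := by
    intro v hv hva
    have := hb.mapsTo (Finset.mem_coe.2 (Finset.mem_erase.2 ⟨hva, hv⟩))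
    simp only [Set.mem_Ioc] at this
    omega
  refine ⟨Function.update b a (lo + S.card), ⟨?_, ?_, ?_⟩, ?_⟩
  · intro v hv
    by_cases hva : v = a
    · subst hva; simp; omega
    · have := hmem v hv hva
      simp [hva]; omega
  · intro u hu v hv huv
    by_cases hua : u = a <;> by_cases hva : v = a
    · rw [hua, hva]
    · have := hmem v hv hva
      simp [hua, hva] at huv; omega
    · have := hmem u hu hua
      simp [hua, hva] at huv; omega
    · simp only [Function.update_of_ne hua, Function.update_of_ne hva] at huv
      exact hb.injOn (Finset.mem_coe.2 (Finset.mem_erase.2 ⟨hua, hu⟩))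
        (Finset.mem_coe.2 (Finset.mem_erase.2 ⟨hva, hv⟩)) huv
  · rintro l ⟨hl, hl'⟩
    by_cases h : l = lo + S.card
    · exact ⟨a, ha, by simp [h]⟩
    · obtain ⟨v, hv, hvl⟩ := hb.surjOn (show l ∈ Set.Ioc lo (lo + (S.erase a).card) from
        ⟨hl, by omega⟩)
      have hv' := Finset.mem_erase.1 (Finset.mem_coe.1 hv)
      exact ⟨v, hv'.2, by simp [hv'.1, hvl]⟩
  · intro u hu v hv huv
    by_cases hva : v = a
    · rw [hva]; exact hmax u hu
    by_cases hua : u = a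
    · have := hmem v hv hva
      simp [hua, hva] at huv; omega
    · simp only [Function.update_of_ne hua, Function.update_of_ne hva] at huv
      exact hbq u (Finset.mem_erase.2 ⟨hua, hu⟩) v (Finset.mem_erase.2 ⟨hva, hv⟩) huv

/-- Every graph has a signed labelling whose imbalances are at most the largest label. -/
theorem exists_balanced_signedLabeling {V : Type*} [Fintype V] [DecidableEq V] (H : SimpleGraph V)
    (lo : ℕ) : ∃ (hi : ℕ) (f : V → V → ℤ), lo ≤ hi ∧ IsSignedLabeling H lo hi f ∧
      ∀ u, |inflow f u| ≤ hi := by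
  classical
  obtain ⟨L, hL, -⟩ := exists_sorted_labels H.edgeFinset (fun _ => 0) lo
  rw [SimpleGraph.coe_edgeFinset] at hL
  set hi := lo + H.edgeFinset.card
  have hmem : ∀ u v, H.Adj u v → lo < L s(u, v) ∧ L s(u, v) ≤ hi := by
    intro u v h
    exact hL.mapsTo (show s(u, v) ∈ H.edgeSet from h)
  obtain ⟨σ, h1, h2, h3, h4⟩ := exists_balanced_orientation H L hi fun e he => (hL.mapsTo he).2
  have habs : ∀ u v, H.Adj u v → |σ u v * (L s(u, v) : ℤ)| = L s(u, v) := by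
    intro u v h
    rcases h2 u v h with h | h <;> simp [h]
  refine ⟨hi, fun u v => σ u v * L s(u, v), by omega, ⟨?_, ?_, ?_, ?_, ?_⟩, h4⟩
  · intro u v
    rw [h1 u v, Sym2.eq_swap]; ring
  · intro u v h
    simp [h3 u v h]
  · intro u v h
    rw [habs u v h]
    have := hmem u v h
    omega
  · intro u v u' v' h h' heq
    rw [habs u v h, habs u' v' h'] at heq
    exact hL.injOn h h' (by exact_mod_cast heq)
  · intro l hl hl'
    obtain ⟨e, he, hel⟩ := hL.surjOn ⟨hl, hl'⟩
    induction e with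
    | _ u v => exact ⟨u, v, he, by rw [habs u v he, hel]⟩

/-- Serves to turn the lower bound on e(G) into a lower bound on M. -/
theorem IsSignedLabeling.card_edgeFinset {V : Type*} [Fintype V] {G : SimpleGraph V}
    [Fintype G.edgeSet] {m : ℕ} {f : V → V → ℤ} (h : IsSignedLabeling G 0 m f) :
    G.edgeFinset.card = m := by
  classical
  have : G.edgeFinset.card = (Finset.Ioc 0 m).card := by
    apply Finset.card_bij (fun e _ => Sym2.lift ⟨fun u v => (f u v).natAbs, fun u v => by
      dsimp only
      rw [h.anti u v, Int.natAbs_neg]⟩ e)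
    · intro e he
      induction e with
      | _ u v =>
        have := h.range u v (by simpa using he)
        rw [Int.abs_eq_natAbs] at this
        simp only [Sym2.lift_mk, Finset.mem_Ioc]
        omega
    · intro e he e' he' heq
      induction e with
      | _ u v =>
        induction e' with
        | _ u' v' =>
          simp only [Sym2.lift_mk] at heq
          exact h.inj u v u' v' (by simpa using he) (by simpa using he')
            (by rw [Int.abs_eq_natAbs, Int.abs_eq_natAbs, heq])
    · intro l hl
      rw [Finset.mem_Ioc] at hl
      obtain ⟨u, v, huv, hl'⟩ := h.surj l hl.1 hl.2
      rw [Int.abs_eq_natAbs] at hl'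
      exact ⟨s(u, v), by simpa using huv, by simp only [Sym2.lift_mk]; omega⟩
  simpa using this

/-- The arcs are the pairs with positive value. Antisymmetry and nonvanishing on edges select
exactly one direction of each edge. -/
theorem IsSignedLabeling.admitsAntimagicOrientation {V : Type*} [Fintype V] {G : SimpleGraph V}
    {m : ℕ} {f : V → V → ℤ} (h : IsSignedLabeling G 0 m f)
    (hs : ∀ u v, u ≠ v → inflow f u ≠ inflow f v) : AdmitsAntimagicOrientation G := by
  classical
  let D : Digraph V := ⟨fun u v => 0 < f u v⟩
  let τ : V × V → ℕ := fun e => (f e.1 e.2).toNat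
  have hadj : ∀ u v, 0 < f u v → G.Adj u v := by
    intro u v huv
    by_contra h'
    rw [h.supp u v h'] at huv
    exact lt_irrefl _ huv
  have hbij : Set.BijOn τ (arcSet D) (Set.Icc 1 m) := by
    refine ⟨?_, ?_, ?_⟩
    · rintro ⟨u, v⟩ huv
      change 0 < f u v at huv
      have := h.range u v (hadj u v huv)
      rw [abs_of_pos huv] at this
      simp only [τ, Set.mem_Icc]
      omega
    · rintro ⟨u, v⟩ huv ⟨u', v'⟩ huv' heq
      change 0 < f u v at huv
      change 0 < f u' v' at huv'
      simp only [τ] at heq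
      have h1 := h.inj u v u' v' (hadj u v huv) (hadj u' v' huv') (by
        rw [abs_of_pos huv, abs_of_pos huv']; omega)
      rcases Sym2.eq_iff.1 h1 with ⟨rfl, rfl⟩ | ⟨rfl, rfl⟩
      · rfl
      · have := h.anti u v
        omega
    · rintro l ⟨hl, hl'⟩
      obtain ⟨u, v, huv, h1⟩ := h.surj l hl hl'
      have h2 := h.anti u v
      rcases lt_or_gt_of_ne (h.ne_zero huv) with h0 | h0
      · refine ⟨(v, u), show 0 < f v u by omega, ?_⟩
        rw [abs_of_neg h0] at h1
        simp only [τ]; omega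
      · refine ⟨(u, v), h0, ?_⟩
        rw [abs_of_pos h0] at h1
        simp only [τ]; omega
  have hcard : (arcSet D).ncard = m := by
    have h1 := hbij.injOn.ncard_image
    rw [hbij.image_eq] at h1
    rw [← h1]
    simp [Set.ncard_eq_toFinset_card']
  have hsum : ∀ u, vertexSum D τ u = inflow f u := by
    intro u
    rw [vertexSum, Finset.sum_filter, Finset.sum_filter, ← Finset.sum_sub_distrib]
    apply Finset.sum_congr rfl
    intro w _
    have h2 := h.anti w u
    simp only [D, τ]
    split_ifs <;> omega
  refine ⟨D, τ, ⟨?_, ?_⟩, ⟨by rw [hcard]; exact hbij, ?_⟩⟩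
  · intro u v
    change G.Adj u v ↔ 0 < f u v ∨ 0 < f v u
    constructor
    · intro huv
      have h1 := h.ne_zero huv
      have h2 := h.anti u v
      omega
    · rintro (h1 | h1)
      · exact hadj u v h1
      · exact (hadj v u h1).symm
  · intro u v huv hvu
    change 0 < f u v at huv
    change 0 < f v u at hvu
    have := h.anti u v
    omega
  · intro u v huv
    rw [hsum, hsum]
    exact hs u v huv

/-! ### The layered labelling -/

/-- Let `N₁` and `N₂` be disjoint vertex sets such that every vertex of `N₂` has a parent in `N₁` and
every vertex of `N₁` has a parent outside `N₁ ∪ N₂`. Label the special edges, joining the vertices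
`v` of `T` to `q v`, by the smallest labels, the other edges that do not join a vertex to its parent
by the next ones, and finally the edges from `N₂` and those from `N₁` to the parents, in the order
of the partial vertex-sums. -/
theorem exists_layered_labeling {V : Type*} [Fintype V] [DecidableEq V] (G : SimpleGraph V)
    (N₁ N₂ : Finset V) (par : V → V) (hdisj : ∀ v ∈ N₁, v ∉ N₂)
    (h₁ : ∀ v ∈ N₁, G.Adj (par v) v ∧ par v ∉ N₁ ∧ par v ∉ N₂)
    (h₂ : ∀ v ∈ N₂, G.Adj (par v) v ∧ par v ∈ N₁)
    (T : Finset V) (q : V → V) (c : V → ℤ) (k : ℕ)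
    (hT : ∀ v ∈ T, G.Adj (q v) v ∧ q v ∉ T)
    (hc : Set.BijOn (fun v => (c v).natAbs) T (Set.Ioc 0 k))
    (hT₁ : ∀ v ∈ T, ∀ w ∈ N₁, s(q v, v) ≠ s(par w, w))
    (hT₂ : ∀ v ∈ T, v ∉ N₂ ∧ q v ∉ N₂)
    (hT₃ : ∀ v ∈ N₁, 0 ≤ inflow (parentFlow T q c) v) :
    ∃ (M : ℕ) (f : V → V → ℤ), k ≤ M ∧ IsSignedLabeling G 0 (M + N₂.card + N₁.card) f ∧
      (∀ v ∈ T, f (q v) v = c v) ∧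
      (∀ v ∈ N₁, (M : ℤ) + N₂.card < f (par v) v) ∧
      (∀ u ∈ N₁, ∀ v ∈ N₁, f (par u) u < f (par v) v →
        inflow f u - f (par u) u ≤ inflow f v - f (par v) v) ∧
      (∀ u ∈ N₁, ∀ v ∈ N₁, u ≠ v → f (par u) u ≠ f (par v) v) ∧
      (∀ u ∈ N₂, ∀ v ∈ N₂, u ≠ v → inflow f u ≠ inflow f v) ∧
      (∀ v ∈ N₂, -(2 * (M : ℤ) + N₂.card) ≤ inflow f v ∧ inflow f v < 0) ∧
      (∀ v ∈ N₁, 0 ≤ inflow f v) ∧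
      ∀ x, x ∉ N₁ → x ∉ N₂ → ∀ C ⊆ N₁, (∀ v ∈ C, par v = x) →
        inflow f x ≤ M + inflow (parentFlow T q c) x - ∑ v ∈ C, f x v ∧
        ((∀ w, G.Adj x w → w ∈ N₁ ∧ par w = x) →
          inflow f x ≤ inflow (parentFlow T q c) x - ∑ v ∈ C, f x v) := by
  classical
  have hp₁ : ∀ v ∈ N₁, par v ∉ N₁ := fun v hv => (h₁ v hv).2.1
  have hp₂ : ∀ v ∈ N₂, par v ∉ N₂ := fun v hv => hdisj _ (h₂ v hv).2
  have hpT : ∀ v ∈ T, q v ∉ T := fun v hv => (hT v hv).2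
  set R₁ := parentGraph N₁ par with hR₁
  set R₂ := parentGraph N₂ par with hR₂
  set P := parentGraph T q with hP
  have hR₁G : R₁ ≤ G := by
    intro u v huv
    rcases (parentGraph_adj hp₁).1 huv with ⟨h, rfl⟩ | ⟨h, rfl⟩
    exacts [(h₁ u h).1.symm, (h₁ v h).1]
  have hR₂G : R₂ ≤ G := by
    intro u v huv
    rcases (parentGraph_adj hp₂).1 huv with ⟨h, rfl⟩ | ⟨h, rfl⟩
    exacts [(h₂ u h).1.symm, (h₂ v h).1]
  have hPG : P ≤ G := by
    intro u v huv
    rcases (parentGraph_adj hpT).1 huv with ⟨h, rfl⟩ | ⟨h, rfl⟩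
    exacts [(hT u h).1.symm, (hT v h).1]
  have hR₁₂ : ∀ u v, R₂.Adj u v → ¬ R₁.Adj u v := by
    intro u v huv huv'
    rcases (parentGraph_adj hp₂).1 huv with ⟨h, rfl⟩ | ⟨h, rfl⟩ <;>
      rcases (parentGraph_adj hp₁).1 huv' with ⟨h', h''⟩ | ⟨h', h''⟩
    · exact hdisj _ h' h
    · exact (h₁ _ h').2.2 (h'' ▸ h)
    · exact (h₁ _ h').2.2 (h'' ▸ h)
    · exact hdisj _ h' h
  have hPR₁ : ∀ u v, P.Adj u v → ¬ R₁.Adj u v := by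
    intro u v huv huv'
    rcases (parentGraph_adj hpT).1 huv with ⟨h, rfl⟩ | ⟨h, rfl⟩ <;>
      rcases (parentGraph_adj hp₁).1 huv' with ⟨h', h''⟩ | ⟨h', h''⟩
    · exact hT₁ _ h _ h' (by rw [h''])
    · exact hT₁ _ h _ h' (by rw [← h'', Sym2.eq_swap])
    · exact hT₁ _ h _ h' (by rw [← h'', Sym2.eq_swap])
    · exact hT₁ _ h _ h' (by rw [h''])
  have hPR₂ : ∀ u v, P.Adj u v → ¬ R₂.Adj u v := by
    intro u v huv huv'
    rcases (parentGraph_adj hpT).1 huv with ⟨h, rfl⟩ | ⟨h, rfl⟩ <;>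
      rcases (parentGraph_adj hp₂).1 huv' with ⟨h', h''⟩ | ⟨h', h''⟩
    exacts [(hT₂ _ h).1 h', (hT₂ _ h).2 h', (hT₂ _ h).2 h', (hT₂ _ h).1 h']
  set H := G \ (P ⊔ R₂ ⊔ R₁) with hH
  have hHadj : ∀ u v, H.Adj u v ↔ G.Adj u v ∧ ¬ (P.Adj u v ∨ R₂.Adj u v ∨ R₁.Adj u v) := by
    intro u v
    simp only [hH, SimpleGraph.sdiff_adj, SimpleGraph.sup_adj, or_assoc]
  have hf₁ := isSignedLabeling_parentFlow hpT hc
  obtain ⟨M, f₀, hkM, hf₀, hM⟩ := exists_balanced_signedLabeling H k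
  -- The label of v enters its sum as `-b₂ v`, so larger labels go to smaller partial sums; hence
  -- the sign in the sorting key.
  obtain ⟨b₂, hb₂, hs₂⟩ := exists_sorted_labels N₂ (fun v => -inflow f₀ v) M
  set f₁ := parentFlow T q c with hf₁def
  set f₂ := parentFlow N₂ par (fun v => -(b₂ v : ℤ)) with hf₂def
  have hf₂ : IsSignedLabeling R₂ M (M + N₂.card) f₂ :=
    isSignedLabeling_parentFlow (c := fun v => -(b₂ v : ℤ)) hp₂ (by simpa using hb₂)
  -- Here labels enter positively, so larger labels go to larger partial sums, which already include
  -- the edges from N₂.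
  obtain ⟨b₁, hb₁, hs₁⟩ := exists_sorted_labels N₁ (inflow (f₁ + f₀ + f₂)) (M + N₂.card)
  set f₃ := parentFlow N₁ par (fun v => (b₁ v : ℤ)) with hf₃def
  have hf₃ : IsSignedLabeling R₁ (M + N₂.card) (M + N₂.card + N₁.card) f₃ :=
    isSignedLabeling_parentFlow (c := fun v => (b₁ v : ℤ)) hp₁ (by simpa using hb₁)
  have hf : IsSignedLabeling G 0 (M + N₂.card + N₁.card) (f₁ + f₀ + f₂ + f₃) := by
    have h := ((hf₁.sup hf₀ (Nat.zero_le _) hkM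
      (fun u v h h' => ((hHadj u v).1 h').2 (Or.inl h))).sup hf₂ (Nat.zero_le _) (by omega) (by
        rintro u v (h | h) h'
        · exact hPR₂ u v h h'
        · exact ((hHadj u v).1 h).2 (Or.inr (Or.inl h')))).sup hf₃ (Nat.zero_le _) (by omega) (by
        rintro u v ((h | h) | h) h'
        · exact hPR₁ u v h h'
        · exact ((hHadj u v).1 h).2 (Or.inr (Or.inr h'))
        · exact hR₁₂ u v h h')
    convert h
    ext u v
    simp only [SimpleGraph.sup_adj, hHadj]
    have := @hPG u v
    have := @hR₁G u v
    have := @hR₂G u v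
    tauto
  have hin : ∀ u, inflow (f₁ + f₀ + f₂ + f₃) u =
      inflow f₁ u + inflow f₀ u + inflow f₂ u + inflow f₃ u := by
    intro u; rw [inflow_add, inflow_add, inflow_add]
  have hb₁mem : ∀ v ∈ N₁, M + N₂.card < b₁ v := fun v hv => (hb₁.mapsTo hv).1
  have hb₂mem : ∀ v ∈ N₂, M < b₂ v ∧ b₂ v ≤ M + N₂.card := fun v hv => hb₂.mapsTo hv
  have h₁₁ : ∀ v ∈ N₂, inflow f₁ v = 0 := by
    intro v hv
    rw [hf₁def, inflow_parentFlow, if_neg fun h => (hT₂ v h).1 hv, Finset.sum_eq_zero, sub_zero]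
    intro w hw
    rw [Finset.mem_filter] at hw
    exact absurd hv (hw.2 ▸ (hT₂ w hw.1).2)
  have h₂₂ : ∀ v ∈ N₂, inflow f₂ v = -b₂ v := by
    intro v hv
    rw [hf₂def, inflow_parentFlow, if_pos hv, Finset.filter_false_of_mem, Finset.sum_empty, sub_zero]
    intro w hw h
    exact hp₂ w hw (h ▸ hv)
  have h₂₁ : ∀ v ∈ N₁, 0 ≤ inflow f₂ v := by
    intro v hv
    rw [hf₂def, inflow_parentFlow, if_neg (hdisj v hv), Finset.sum_neg_distrib]
    have : 0 ≤ ∑ w ∈ N₂ with par w = v, (b₂ w : ℤ) := Finset.sum_nonneg fun w _ => by positivity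
    linarith
  have h₂₀ : ∀ v, v ∉ N₁ → v ∉ N₂ → inflow f₂ v = 0 := by
    intro v hv hv'
    rw [hf₂def, inflow_parentFlow, if_neg hv', Finset.filter_false_of_mem, Finset.sum_empty, sub_zero]
    intro w hw h
    exact hv (h ▸ (h₂ w hw).2)
  have h₃₁ : ∀ v ∈ N₁, inflow f₃ v = b₁ v := by
    intro v hv
    rw [hf₃def, inflow_parentFlow, if_pos hv, Finset.filter_false_of_mem, Finset.sum_empty, sub_zero]
    intro w hw h
    exact hp₁ w hw (h ▸ hv)
  have h₃₂ : ∀ v ∈ N₂, inflow f₃ v = 0 := by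
    intro v hv
    rw [hf₃def, inflow_parentFlow, if_neg fun h => hdisj v h hv, Finset.filter_false_of_mem,
      Finset.sum_empty, sub_zero]
    intro w hw h
    exact (h₁ w hw).2.2 (h ▸ hv)
  have hval₁ : ∀ v ∈ N₁, (f₁ + f₀ + f₂ + f₃) (par v) v = b₁ v := by
    intro v hv
    have ha : R₁.Adj (par v) v := (parentGraph_adj hp₁).2 (Or.inr ⟨hv, rfl⟩)
    simp only [Pi.add_apply]
    rw [hf₁.supp _ _ fun h => hPR₁ _ _ h ha, hf₂.supp _ _ fun h => hR₁₂ _ _ h ha,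
      hf₀.supp _ _ fun h => ((hHadj _ _).1 h).2 (Or.inr (Or.inr ha)), hf₃def,
      parentFlow_parent hp₁ _ hv]
    simp
  have hvalT : ∀ v ∈ T, (f₁ + f₀ + f₂ + f₃) (q v) v = c v := by
    intro v hv
    have ha : P.Adj (q v) v := (parentGraph_adj hpT).2 (Or.inr ⟨hv, rfl⟩)
    simp only [Pi.add_apply]
    rw [hf₃.supp _ _ fun h => hPR₁ _ _ ha h, hf₂.supp _ _ fun h => hPR₂ _ _ ha h,
      hf₀.supp _ _ fun h => ((hHadj _ _).1 h).2 (Or.inl ha), hf₁def,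
      parentFlow_parent hpT _ hv]
    simp
  refine ⟨M, f₁ + f₀ + f₂ + f₃, hkM, hf, hvalT, ?_, ?_, ?_, ?_, ?_, ?_, ?_⟩
  · intro v hv
    rw [hval₁ v hv]
    exact_mod_cast hb₁mem v hv
  · intro u hu v hv huv
    rw [hval₁ u hu, hval₁ v hv] at huv ⊢
    rw [inflow_add _ f₃, inflow_add _ f₃, h₃₁ u hu, h₃₁ v hv]
    have := hs₁ u hu v hv (by exact_mod_cast huv)
    linarith
  · intro u hu v hv huv
    rw [hval₁ u hu, hval₁ v hv]
    exact fun h => huv (hb₁.injOn hu hv (by exact_mod_cast h))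
  · intro u hu v hv huv
    have hne : b₂ u ≠ b₂ v := fun h => huv (hb₂.injOn hu hv h)
    rw [hin, hin, h₁₁ u hu, h₁₁ v hv, h₂₂ u hu, h₂₂ v hv, h₃₂ u hu, h₃₂ v hv]
    rcases lt_or_gt_of_ne hne with h | h
    · have := hs₂ u hu v hv h
      omega
    · have := hs₂ v hv u hu h
      omega
  -- The balanced part lies in [-M, M] and `b₂ v` in (M, M + n₂].
  · intro v hv
    rw [hin, h₁₁ v hv, h₂₂ v hv, h₃₂ v hv]
    have h3 := abs_le.1 (hM v)
    have := hb₂mem v hv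
    omega
  -- The parent label exceeds M and absorbs the balanced part; edges from N₂ and special edges
  -- contribute nonnegatively.
  · intro v hv
    rw [hin, h₃₁ v hv]
    have h3 := abs_le.1 (hM v)
    have := hb₁mem v hv
    have := h₂₁ v hv
    have := hT₃ v hv
    omega
  · intro x hx hx' C hC hCx
    have hle : ∑ v ∈ C, (f₁ + f₀ + f₂ + f₃) x v ≤ ∑ v ∈ N₁ with par v = x, (b₁ v : ℤ) := by
      rw [Finset.sum_congr rfl (g := fun v => (b₁ v : ℤ)) fun v hv => by
        rw [← hCx v hv]; exact hval₁ v (hC hv)]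
      exact Finset.sum_le_sum_of_subset_of_nonneg
        (fun v hv => Finset.mem_filter.2 ⟨hC hv, hCx v hv⟩) fun v _ _ => by positivity
    have h3 : inflow f₃ x = -∑ v ∈ N₁ with par v = x, (b₁ v : ℤ) := by
      rw [hf₃def, inflow_parentFlow, if_neg hx, zero_sub]
    rw [hin, h₂₀ x hx hx', h3]
    -- The balanced part adds at most M. If every edge at x leads to a child, no edge at x is in `H`
    -- and it adds 0.
    constructor
    · have := (abs_le.1 (hM x)).2
      linarith
    · intro hall
      have : inflow f₀ x = 0 := by
        apply Finset.sum_eq_zero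
        intro w _
        apply hf₀.supp
        intro h
        obtain ⟨h4, h5⟩ := (hHadj w x).1 h
        obtain ⟨h6, h7⟩ := hall w h4.symm
        exact h5 (Or.inr (Or.inr ((parentGraph_adj hp₁).2 (Or.inl ⟨h6, h7.symm⟩))))
      linarith

/-! ### Graphs within distance two of the centres -/

theorem bijOn_singleton_Ioc {V : Type*} {a : V} {c : V → ℤ} (ha : (c a).natAbs = 1) :
    Set.BijOn (fun v => (c v).natAbs) (({a} : Finset V) : Set V) (Set.Ioc 0 1) := by
  rw [Finset.coe_singleton]
  refine ⟨?_, Set.injOn_singleton _ _, ?_⟩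
  · rintro v rfl; simp [ha]
  · rintro l ⟨h, h'⟩
    obtain rfl : l = 1 := by omega
    exact ⟨a, rfl, ha⟩

theorem bijOn_pair_Ioc {V : Type*} [DecidableEq V] {a b : V} {c : V → ℤ}
    (ha : (c a).natAbs = 1) (hb : (c b).natAbs = 2) :
    Set.BijOn (fun v => (c v).natAbs) (({a, b} : Finset V) : Set V) (Set.Ioc 0 2) := by
  rw [Finset.coe_insert, Finset.coe_singleton]
  refine ⟨?_, ?_, ?_⟩
  · rintro v (rfl | rfl) <;> simp [ha, hb]
  · rintro u (rfl | rfl) v (rfl | rfl) h <;> simp_all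
  · rintro l ⟨h, h'⟩
    obtain rfl | rfl : l = 1 ∨ l = 2 := by omega
    exacts [⟨a, by simp, ha⟩, ⟨b, by simp, hb⟩]

/-- Connectedness provides a walk of length `dist`; otherwise a distance 0 could mean
unreachability. -/
theorem SimpleGraph.Connected.exists_common_neighbor_of_dist_le_two {V : Type*} {G : SimpleGraph V}
    (hG : G.Connected) {v x : V} (hvx : v ≠ x) (hd : G.dist v x ≤ 2) :
    G.Adj x v ∨ ∃ w, G.Adj w v ∧ G.Adj x w := by
  obtain ⟨p, hp⟩ := hG.exists_walk_length_eq_dist v x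
  match p, hp with
  | .nil, _ => exact absurd rfl hvx
  | .cons h .nil, _ => exact Or.inl h.symm
  | .cons h (.cons h' .nil), _ => exact Or.inr ⟨_, h.symm, h'.symm⟩
  | .cons _ (.cons _ (.cons _ _)), hp =>
    simp only [SimpleGraph.Walk.length_cons] at hp
    omega

/-- The layered labelling of a graph all of whose vertices are within distance two of `X`, where the
vertices `y i` have prescribed parents `p i` in `X`. -/
theorem exists_labeling_of_dist_le_two {V : Type*} [Fintype V] [DecidableEq V] (G : SimpleGraph V)
    [DecidableRel G.Adj] (hG : G.Connected) (X : Finset V)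
    (hX : ∀ v : V, v ∉ X → ∃ x ∈ X, G.dist v x ≤ 2)
    (n : ℕ) (y p : ℕ → V) (hy : Set.InjOn y (Set.Icc 1 n)) (hyX : ∀ i ∈ Set.Icc 1 n, y i ∉ X)
    (hp : ∀ i ∈ Set.Icc 1 n, p i ∈ X ∧ G.Adj (p i) (y i))
    (T : Finset V) (q : V → V) (c : V → ℤ) (k : ℕ)
    (hT : ∀ v ∈ T, G.Adj (q v) v ∧ q v ∉ T)
    (hc : Set.BijOn (fun v => (c v).natAbs) T (Set.Ioc 0 k))
    (hTX : ∀ v ∈ T, (v ∈ X ∨ ∃ i ∈ Set.Icc 1 n, v = y i) ∧ (q v ∈ X ∨ ∃ i ∈ Set.Icc 1 n, q v = y i))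
    (hTp : ∀ v ∈ T, ∀ i ∈ Set.Icc 1 n, s(q v, v) ≠ s(p i, y i))
    (hT₀ : ∀ v ∉ X, 0 ≤ inflow (parentFlow T q c) v) :
    ∃ (M n₁ n₂ : ℕ) (f : V → V → ℤ), k ≤ M ∧ IsSignedLabeling G 0 (M + n₂ + n₁) f ∧
      n₁ + n₂ + X.card = Fintype.card V ∧
      (∀ v ∈ T, f (q v) v = c v) ∧
      (∀ i ∈ Set.Icc 1 n, (M : ℤ) + n₂ < f (p i) (y i) ∧ f (p i) (y i) ≤ M + n₂ + n₁) ∧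
      (∀ i ∈ Set.Icc 1 n, ∀ j ∈ Set.Icc 1 n, f (p j) (y j) = f (p i) (y i) + 1 →
        inflow f (y i) < inflow f (y j) ∧ ∀ v ∉ X, v ≠ y i → v ≠ y j →
          inflow f v < inflow f (y i) ∨ inflow f (y j) < inflow f v) ∧
      (∀ u ∉ X, ∀ v ∉ X, u ≠ v → inflow f u ≠ inflow f v) ∧
      (∀ v ∉ X, -(2 * (M : ℤ) + n₂) ≤ inflow f v) ∧
      ∀ x ∈ X, ∀ C ⊆ Finset.Icc 1 n, (∀ i ∈ C, p i = x) →
        inflow f x ≤ M + inflow (parentFlow T q c) x - ∑ i ∈ C, f x (y i) ∧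
        (X = {x} → inflow f x ≤ inflow (parentFlow T q c) x - ∑ i ∈ C, f x (y i)) := by
  classical
  set N₁ : Finset V := Finset.univ.filter fun v => v ∉ X ∧ ∃ x ∈ X, G.Adj x v with hN₁
  set N₂ : Finset V := Finset.univ.filter fun v => v ∉ X ∧ ¬ ∃ x ∈ X, G.Adj x v with hN₂
  have mem₁ : ∀ v, v ∈ N₁ ↔ v ∉ X ∧ ∃ x ∈ X, G.Adj x v := by intro v; simp [hN₁]
  have mem₂ : ∀ v, v ∈ N₂ ↔ v ∉ X ∧ ¬ ∃ x ∈ X, G.Adj x v := by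
    intro v; rw [hN₂, Finset.mem_filter]; simp
  have hdisj : ∀ v ∈ N₁, v ∉ N₂ := fun v h h' => ((mem₂ v).1 h').2 ((mem₁ v).1 h).2
  have hcov : ∀ v, v ∉ X → v ∈ N₁ ∨ v ∈ N₂ := by
    intro v hv
    rw [mem₁, mem₂]
    by_cases h : ∃ x ∈ X, G.Adj x v
    exacts [Or.inl ⟨hv, h⟩, Or.inr ⟨hv, h⟩]
  have hyN : ∀ i ∈ Set.Icc 1 n, y i ∈ N₁ := fun i hi =>
    (mem₁ _).2 ⟨hyX i hi, p i, hp i hi⟩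
  have hpar : ∀ v, ∃ w, (v ∈ N₁ → w ∈ X ∧ G.Adj w v) ∧ (v ∈ N₂ → w ∈ N₁ ∧ G.Adj w v) ∧
      ∀ i ∈ Set.Icc 1 n, y i = v → w = p i := by
    intro v
    by_cases h : ∃ i ∈ Set.Icc 1 n, y i = v
    · obtain ⟨i, hi, rfl⟩ := h
      refine ⟨p i, fun _ => hp i hi, fun h => absurd h (hdisj _ (hyN i hi)), fun j hj hji => ?_⟩
      rw [hy hj hi hji]
    have h' : ∀ w, ∀ i ∈ Set.Icc 1 n, y i = v → w = p i := fun w i hi hiv => absurd ⟨i, hi, hiv⟩ h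
    by_cases hv : v ∈ X
    -- Centres need no parent, so v is a dummy value.
    · exact ⟨v, fun h => absurd hv ((mem₁ v).1 h).1, fun h => absurd hv ((mem₂ v).1 h).1, h' v⟩
    rcases hcov v hv with hv' | hv'
    · obtain ⟨x, hx, hxv⟩ := ((mem₁ v).1 hv').2
      exact ⟨x, fun _ => ⟨hx, hxv⟩, fun h => absurd h (hdisj v hv'), h' x⟩
    · obtain ⟨x, hx, hd⟩ := hX v hv
      have hno := ((mem₂ v).1 hv').2
      rcases hG.exists_common_neighbor_of_dist_le_two (fun h => hv (by rw [h]; exact hx)) hd with h1 | ⟨w, hw, hw'⟩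
      · exact absurd ⟨x, hx, h1⟩ hno
      · exact ⟨w, fun h => absurd hv' (hdisj v h),
          fun _ => ⟨(mem₁ w).2 ⟨fun hwX => hno ⟨w, hwX, hw⟩, x, hx, hw'⟩, hw⟩, h' w⟩
  choose par hpar₁ hpar₂ hpary using hpar
  have hpy : ∀ i ∈ Set.Icc 1 n, par (y i) = p i := fun i hi => hpary _ i hi rfl
  have hXN : ∀ x ∈ X, x ∉ N₁ ∧ x ∉ N₂ := fun x hx =>
    ⟨fun h => ((mem₁ x).1 h).1 hx, fun h => ((mem₂ x).1 h).1 hx⟩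
  have hend : ∀ v, (v ∈ X ∨ ∃ i ∈ Set.Icc 1 n, v = y i) → v ∉ N₂ := by
    rintro v (h | ⟨i, hi, rfl⟩)
    exacts [(hXN v h).2, hdisj _ (hyN i hi)]
  have hend₁ : ∀ v, (v ∈ X ∨ ∃ i ∈ Set.Icc 1 n, v = y i) → v ∈ N₁ →
      ∃ i ∈ Set.Icc 1 n, v = y i := by
    rintro v (h | h) hv
    exacts [absurd hv (hXN v h).1, h]
  obtain ⟨M, f, hkM, hf, hfT, hfl, hsort, hne, hinj₂, hb₂, hb₁, hx⟩ :=
    exists_layered_labeling G N₁ N₂ par hdisj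
      (fun v hv => ⟨(hpar₁ v hv).2, hXN _ (hpar₁ v hv).1⟩)
      (fun v hv => ⟨(hpar₂ v hv).2, (hpar₂ v hv).1⟩) T q c k hT hc
      (by
        intro v hv w hw heq
        have hw' : ∃ i ∈ Set.Icc 1 n, w = y i := by
          rcases Sym2.eq_iff.1 heq with ⟨-, rfl⟩ | ⟨rfl, -⟩
          · exact hend₁ _ (hTX _ hv).1 hw
          · exact hend₁ _ (hTX _ hv).2 hw
        obtain ⟨i, hi, rfl⟩ := hw'
        rw [hpy i hi] at heq
        exact hTp v hv i hi heq)
      (fun v hv => ⟨hend _ (hTX v hv).1, hend _ (hTX v hv).2⟩)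
      (fun v hv => hT₀ v ((mem₁ v).1 hv).1)
  have hlt : ∀ u ∈ N₁, ∀ v ∈ N₁, f (par u) u < f (par v) v → inflow f u < inflow f v := by
    intro u hu v hv huv
    have := hsort u hu v hv huv
    linarith
  refine ⟨M, N₁.card, N₂.card, f, hkM, hf, ?_, hfT, ?_, ?_, ?_, ?_, ?_⟩
  · rw [← Finset.card_union_of_disjoint (Finset.disjoint_left.2 hdisj),
      ← Finset.card_union_of_disjoint, ← Finset.card_univ]
    · congr 1
      ext v
      simp only [Finset.mem_union, Finset.mem_univ, iff_true]
      have := hcov v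
      tauto
    · rw [Finset.disjoint_right]
      intro x hx h
      rcases Finset.mem_union.1 h with h | h
      exacts [(hXN x hx).1 h, (hXN x hx).2 h]
  · intro i hi
    have h1 := hfl _ (hyN i hi)
    rw [hpy i hi] at h1
    have h2 := (hf.range _ _ (hp i hi).2).2
    have h3 := le_abs_self (f (p i) (y i))
    push_cast at h2
    exact ⟨h1, h3.trans h2⟩
  · intro i hi j hj hij
    rw [← hpy i hi, ← hpy j hj] at hij
    -- On N₁ the sums are ordered as the parent labels, and no integer lies strictly between
    -- consecutive labels; N₂ lies below N₁.
    refine ⟨hlt _ (hyN i hi) _ (hyN j hj) (by omega), fun v hv hvi hvj => ?_⟩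
    rcases hcov v hv with hv' | hv'
    · have h1 := hne _ hv' _ (hyN i hi) hvi
      have h2 := hne _ hv' _ (hyN j hj) hvj
      rcases lt_or_gt_of_ne h1 with h | h
      · exact Or.inl (hlt _ hv' _ (hyN i hi) h)
      · exact Or.inr (hlt _ (hyN j hj) _ hv' (by omega))
    · exact Or.inl (lt_of_lt_of_le (hb₂ v hv').2 (hb₁ _ (hyN i hi)))
  · intro u hu v hv huv
    rcases hcov u hu with hu' | hu' <;> rcases hcov v hv with hv' | hv'
    · rcases lt_or_gt_of_ne (hne u hu' v hv' huv) with h | h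
      · exact (hlt _ hu' _ hv' h).ne
      · exact (hlt _ hv' _ hu' h).ne'
    · exact (lt_of_lt_of_le (hb₂ v hv').2 (hb₁ u hu')).ne'
    · exact (lt_of_lt_of_le (hb₂ u hu').2 (hb₁ v hv')).ne
    · exact hinj₂ u hu' v hv' huv
  · intro v hv
    rcases hcov v hv with hv' | hv'
    · have := hb₁ v hv'
      omega
    · exact (hb₂ v hv').1
  · intro x hxX C hC hCx
    have hC' : ∀ i ∈ C, i ∈ Set.Icc 1 n := fun i hi => by simpa using hC hi
    have h1 := hx x (hXN x hxX).1 (hXN x hxX).2 (C.image y)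
      (by
        intro v hv
        obtain ⟨i, hi, rfl⟩ := Finset.mem_image.1 hv
        exact hyN i (hC' i hi))
      (by
        intro v hv
        obtain ⟨i, hi, rfl⟩ := Finset.mem_image.1 hv
        rw [hpy i (hC' i hi), hCx i hi])
    rw [Finset.sum_image fun i hi j hj h => hy (hC' i hi) (hC' j hj) h] at h1
    refine ⟨h1.1, fun hXx => h1.2 fun w hw => ?_⟩
    -- A neighbour of the only centre has no other possible parent.
    have hw₁ : w ∈ N₁ := (mem₁ w).2 ⟨by simpa [hXx] using hw.ne', x, hxX, hw⟩
    exact ⟨hw₁, by simpa [hXx] using (hpar₁ w hw₁).1⟩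

/-! ### One or two centres -/

/-- If the vertex-sums outside `X` are distinct and larger than those in `X`, only the vertices of
`X` have to be compared with each other. -/
theorem IsSignedLabeling.admitsAntimagicOrientation_of_separated {V : Type*} [Fintype V]
    {G : SimpleGraph V} {m : ℕ} {f : V → V → ℤ} (h : IsSignedLabeling G 0 m f) {X : Finset V} {B : ℤ}
    (hinj : ∀ u ∉ X, ∀ v ∉ X, u ≠ v → inflow f u ≠ inflow f v)
    (hB : ∀ v ∉ X, B ≤ inflow f v) (hX : ∀ x ∈ X, inflow f x < B)
    (hXX : ∀ x ∈ X, ∀ x' ∈ X, x ≠ x' → inflow f x ≠ inflow f x') :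
    AdmitsAntimagicOrientation G := by
  apply h.admitsAntimagicOrientation
  intro u v huv
  by_cases hu : u ∈ X <;> by_cases hv : v ∈ X
  · exact hXX u hu v hv huv
  · exact ((hX u hu).trans_le (hB v hv)).ne
  · exact ((hX v hv).trans_le (hB u hu)).ne'
  · exact hinj u hu v hv huv

/-- A graph dominated at distance two by a vertex of degree at least two. -/
theorem admitsAntimagicOrientation_of_singleton {V : Type*} [Fintype V] [DecidableEq V]
    (G : SimpleGraph V) [DecidableRel G.Adj] (hG : G.Connected) (x : V)
    (hX : ∀ v : V, v ∉ ({x} : Finset V) → ∃ x' ∈ ({x} : Finset V), G.dist v x' ≤ 2)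
    (hdeg : 2 ≤ G.degree x) : AdmitsAntimagicOrientation G := by
  obtain ⟨a, ha, b, hb, hab⟩ := Finset.one_lt_card.1 (show 1 < (G.neighborFinset x).card from hdeg)
  rw [SimpleGraph.mem_neighborFinset] at ha hb
  obtain ⟨M, n₁, n₂, f, -, hf, -, -, hl, -, hinj, hB, hx⟩ :=
    exists_labeling_of_dist_le_two G hG {x} hX 2 (fun i => if i = 1 then a else b) (fun _ => x)
      (by
        rintro i ⟨hi, hi'⟩ j ⟨hj, hj'⟩ h
        interval_cases i <;> interval_cases j <;> simp_all)
      (by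
        rintro i ⟨hi, hi'⟩
        interval_cases i
        · simpa using ha.ne'
        · simpa using hb.ne')
      (by
        rintro i ⟨hi, hi'⟩
        interval_cases i <;> simp [ha, hb])
      ∅ id 0 0 (by simp) (by simp) (by simp) (by simp)
      (by intro v _; rw [inflow_parentFlow]; simp)
  -- The sharper bound without M: already -2(M + n₂ + 1) is below -(2M + n₂).
  have h1 := (hx x (by simp) {1, 2} (by decide) (by simp)).2 rfl
  have h2 := hl 1 (by simp)
  have h3 := hl 2 (by simp)
  rw [inflow_parentFlow] at h1
  simp at h1 h2 h3
  refine hf.admitsAntimagicOrientation_of_separated hinj hB ?_ ?_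
  · intro x' hx'
    rw [Finset.mem_singleton.1 hx']
    omega
  · intro u hu v hv huv
    exact absurd ((Finset.mem_singleton.1 hu).trans (Finset.mem_singleton.1 hv).symm) huv

/-- Two centres joined by an edge. -/
theorem admitsAntimagicOrientation_of_adjacent_pair {V : Type*} [Fintype V] [DecidableEq V]
    (G : SimpleGraph V) [DecidableRel G.Adj] (hG : G.Connected) (x₁ x₂ : V)
    (hX : ∀ v : V, v ∉ ({x₁, x₂} : Finset V) → ∃ x ∈ ({x₁, x₂} : Finset V), G.dist v x ≤ 2)
    (y : ℕ → V) (hy : Set.InjOn y (Set.Icc 1 7))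
    (hyX : ∀ i ∈ Set.Icc 1 7, y i ∉ ({x₁, x₂} : Finset V)) (hadj : G.Adj x₁ x₂)
    (h₁ : ∀ i ∈ Set.Icc 1 3, G.Adj x₁ (y i)) (h₂ : ∀ i ∈ Set.Icc 4 7, G.Adj x₂ (y i)) :
    AdmitsAntimagicOrientation G := by
  have hne := hadj.ne
  have hne' := hne.symm
  obtain ⟨M, n₁, n₂, f, -, hf, -, hfT, hl, -, hinj, hB, hx⟩ :=
    exists_labeling_of_dist_le_two G hG {x₁, x₂} hX 7 y (fun i => if i ≤ 3 then x₁ else x₂) hy hyX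
      (by
        rintro i ⟨hi, hi'⟩
        by_cases h : i ≤ 3
        · simp [h, h₁ i ⟨hi, h⟩]
        · simp [h, h₂ i ⟨by omega, hi'⟩])
      -- The only special arc goes from `x₂` to `x₁` and has label 1.
      {x₁} (fun _ => x₂) (fun _ => 1) 1 (by simp [hadj.symm, hne.symm]) (bijOn_singleton_Ioc rfl)
      (by simp)
      (by
        intro v hv i hi h
        rw [Finset.mem_singleton.1 hv, Sym2.eq_iff] at h
        have := hyX i hi
        rcases h with ⟨-, h⟩ | ⟨h, -⟩ <;> simp [← h] at this)
      (by
        intro v hv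
        simp only [Finset.mem_insert, Finset.mem_singleton, not_or] at hv
        rw [inflow_parentFlow]
        simp [hv.1, Ne.symm hv.2])
  -- M - 3(M + n₂ + 1) leaves enough room below -(2M + n₂) for the special arc in either direction.
  have hs1 := (hx x₁ (by simp) {1, 2, 3} (by decide) (by simp)).1
  have hs2 := (hx x₂ (by simp) {5, 6, 7} (by decide) (by simp)).1
  have hl1 := hl 1 (by simp)
  have hl2 := hl 2 (by simp)
  have hl3 := hl 3 (by simp)
  have hl5 := hl 5 (by simp)
  have hl6 := hl 6 (by simp)
  have hl7 := hl 7 (by simp)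
  have h21 := hfT x₁ (by simp)
  rw [inflow_parentFlow] at hs1 hs2
  simp [hne'] at hs1 hs2 hl1 hl2 hl3 hl5 hl6 hl7 h21
  by_cases heq : inflow f x₁ = inflow f x₂
  · obtain ⟨f', hf', hs⟩ := hf.exists_flip hadj.symm
    have hout : ∀ v ∉ ({x₁, x₂} : Finset V), inflow f' v = inflow f v := by
      intro v hv
      simp only [Finset.mem_insert, Finset.mem_singleton, not_or] at hv
      simp [hs, hv.1, hv.2]
    have e1 := hs x₁
    have e2 := hs x₂
    simp [h21, hne, hne'] at e1 e2
    refine hf'.admitsAntimagicOrientation_of_separated (X := {x₁, x₂})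
      (fun u hu v hv huv => by rw [hout u hu, hout v hv]; exact hinj u hu v hv huv)
      (fun v hv => by rw [hout v hv]; exact hB v hv) ?_ ?_
    · simp only [Finset.mem_insert, Finset.mem_singleton]
      rintro x (rfl | rfl) <;> omega
    · simp only [Finset.mem_insert, Finset.mem_singleton]
      rintro x (rfl | rfl) x' (rfl | rfl) h <;> first | exact absurd rfl h | omega
  · refine hf.admitsAntimagicOrientation_of_separated hinj hB ?_ ?_
    · simp only [Finset.mem_insert, Finset.mem_singleton]
      rintro x (rfl | rfl) <;> omega
    · simp only [Finset.mem_insert, Finset.mem_singleton]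
      rintro x (rfl | rfl) x' (rfl | rfl) h <;> first | exact absurd rfl h | omega

/-- Two centres with a common neighbour. -/
theorem admitsAntimagicOrientation_of_pair {V : Type*} [Fintype V] [DecidableEq V]
    (G : SimpleGraph V) [DecidableRel G.Adj] (hG : G.Connected) (x₁ x₂ : V) (hne : x₁ ≠ x₂)
    (hX : ∀ v : V, v ∉ ({x₁, x₂} : Finset V) → ∃ x ∈ ({x₁, x₂} : Finset V), G.dist v x ≤ 2)
    (y : ℕ → V) (hy : Set.InjOn y (Set.Icc 1 7))
    (hyX : ∀ i ∈ Set.Icc 1 7, y i ∉ ({x₁, x₂} : Finset V))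
    (h₁ : ∀ i ∈ Set.Icc 1 4, G.Adj x₁ (y i)) (h₂ : ∀ i ∈ Set.Icc 4 7, G.Adj x₂ (y i)) :
    AdmitsAntimagicOrientation G := by
  have hne' := hne.symm
  have h4 := hyX 4 (by simp)
  simp only [Finset.mem_insert, Finset.mem_singleton, not_or] at h4
  obtain ⟨h41, h42⟩ := h4
  obtain ⟨M, n₁, n₂, f, hkM, hf, -, hfT, hl, -, hinj, hB, hx⟩ :=
    exists_labeling_of_dist_le_two G hG {x₁, x₂} hX 7 y (fun i => if i ≤ 4 then x₁ else x₂) hy hyX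
      (by
        rintro i ⟨hi, hi'⟩
        by_cases h : i ≤ 4
        · simp [h, h₁ i ⟨hi, h⟩]
        · simp [h, h₂ i ⟨by omega, hi'⟩])
      -- The arc from `x₂` to `y 4` has label 1, while the parent arc from `x₁` to `y 4` has a large
      -- label.
      {y 4} (fun _ => x₂) (fun _ => 1) 1 (by simp [h₂ 4 (by simp), Ne.symm h42])
      (bijOn_singleton_Ioc rfl)
      (by
        intro v hv
        rw [Finset.mem_singleton.1 hv]
        exact ⟨Or.inr ⟨4, by simp, rfl⟩, by simp⟩)
      (by
        intro v hv i hi h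
        rw [Finset.mem_singleton.1 hv, Sym2.eq_iff] at h
        have := hyX i hi
        rcases h with ⟨h, h'⟩ | ⟨h, -⟩
        · rw [← hy (show 4 ∈ Set.Icc 1 7 by simp) hi h'] at h
          simp [hne'] at h
        · simp [← h] at this)
      (by
        intro v hv
        simp only [Finset.mem_insert, Finset.mem_singleton, not_or] at hv
        rw [inflow_parentFlow]
        simp only [Finset.sum_filter, Finset.sum_singleton, Finset.mem_singleton, Ne.symm hv.2,
          if_false]
        split_ifs <;> simp)
  -- A fourth child is counted because the swap takes the large label at `y 4` away from `x₁`; three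
  -- others must remain.
  have hs1 := (hx x₁ (by simp) {1, 2, 3, 4} (by decide) (by simp)).1
  have hs2 := (hx x₂ (by simp) {5, 6, 7} (by decide) (by simp)).1
  have hl1 := hl 1 (by simp)
  have hl2 := hl 2 (by simp)
  have hl3 := hl 3 (by simp)
  have hl4 := hl 4 (by simp)
  have hl5 := hl 5 (by simp)
  have hl6 := hl 6 (by simp)
  have hl7 := hl 7 (by simp)
  have h24 := hfT (y 4) (by simp)
  rw [inflow_parentFlow] at hs1 hs2
  simp [hne', Ne.symm h41, Ne.symm h42] at hs1 hs2 hl1 hl2 hl3 hl4 hl5 hl6 hl7 h24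
  by_cases heq : inflow f x₁ = inflow f x₂
  · obtain ⟨f', hf', -, -, -, hs⟩ := hf.exists_swap (h₁ 4 (by simp)) (h₂ 4 (by simp))
      (by rw [Ne, Sym2.eq_iff]; simp [hne, Ne.symm h41])
    have hout : ∀ v ∉ ({x₁, x₂} : Finset V), inflow f' v = inflow f v := by
      intro v hv
      simp only [Finset.mem_insert, Finset.mem_singleton, not_or] at hv
      simp [hs, hv.1, hv.2]
    have e1 := hs x₁
    have e2 := hs x₂
    simp [h24, hne, hne', Ne.symm h41, Ne.symm h42] at e1 e2
    refine hf'.admitsAntimagicOrientation_of_separated (X := {x₁, x₂})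
      (fun u hu v hv huv => by rw [hout u hu, hout v hv]; exact hinj u hu v hv huv)
      (fun v hv => by rw [hout v hv]; exact hB v hv) ?_ ?_
    · simp only [Finset.mem_insert, Finset.mem_singleton]
      rintro x (rfl | rfl) <;> omega
    · simp only [Finset.mem_insert, Finset.mem_singleton]
      rintro x (rfl | rfl) x' (rfl | rfl) h <;> first | exact absurd rfl h | omega
  · refine hf.admitsAntimagicOrientation_of_separated hinj hB ?_ ?_
    · simp only [Finset.mem_insert, Finset.mem_singleton]
      rintro x (rfl | rfl) <;> omega
    · simp only [Finset.mem_insert, Finset.mem_singleton]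
      rintro x (rfl | rfl) x' (rfl | rfl) h <;> first | exact absurd rfl h | omega

/-! ### Three centres -/

/-- Over the four choices of (u, w), the collision of a pair prescribes 2u + w, u + 2w or w - u.
Each form takes four different values unless b = 2a, a = 2b or a = b respectively, so each pair
spoils at most one choice. If a = b, the only repeated value of w - u is 0, which s₁ ≠ s₃ excludes.
-/
theorem exists_shift_pair_distinct (s₁ s₂ s₃ a b : ℤ) (ha : 0 < a) (hb : 0 < b)
    (h : (a ≠ b ∧ a ≠ 2 * b ∧ b ≠ 2 * a) ∨ (a = b ∧ s₁ ≠ s₃)) :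
    ∃ u w : ℤ, (u = 0 ∨ u = a) ∧ (w = 0 ∨ w = b) ∧
      s₁ + u ≠ s₂ - u - w ∧ s₁ + u ≠ s₃ + w ∧ s₂ - u - w ≠ s₃ + w := by
  by_contra hcon
  push Not at hcon
  have h1 := hcon 0 0 (Or.inl rfl) (Or.inl rfl)
  have h2 := hcon a 0 (Or.inr rfl) (Or.inl rfl)
  have h3 := hcon 0 b (Or.inl rfl) (Or.inr rfl)
  have h4 := hcon a b (Or.inr rfl) (Or.inr rfl)
  omega

/-- The four distributions of b, 1, 2 give each pair four different label differences once b > 3, so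
three pairs spoil at most three of them. For b = 3 some of these differences coincide. -/
theorem exists_swap_distinct (d₁ d₂ d₃ b : ℤ) (hb : 3 < b) :
    (d₁ - b ≠ d₂ - 1 ∧ d₁ - b ≠ d₃ - 2 ∧ d₂ - 1 ≠ d₃ - 2) ∨
    (d₁ - 1 ≠ d₂ - b ∧ d₁ - 1 ≠ d₃ - 2 ∧ d₂ - b ≠ d₃ - 2) ∨
    (d₁ - 2 ≠ d₂ - 1 ∧ d₁ - 2 ≠ d₃ - b ∧ d₂ - 1 ≠ d₃ - b) ∨
    (d₁ - b ≠ d₂ - 2 ∧ d₁ - b ≠ d₃ - 1 ∧ d₂ - 2 ≠ d₃ - 1) := by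
  omega

theorem IsSignedLabeling.admitsAntimagicOrientation_of_triple {V : Type*} [Fintype V]
    [DecidableEq V] {G : SimpleGraph V} {m : ℕ} {f g : V → V → ℤ} (h : IsSignedLabeling G 0 m f)
    {x₁ x₂ x₃ : V} {B : ℤ}
    (hout : ∀ v ∉ ({x₁, x₂, x₃} : Finset V), inflow f v = inflow g v)
    (hinj : ∀ u ∉ ({x₁, x₂, x₃} : Finset V), ∀ v ∉ ({x₁, x₂, x₃} : Finset V), u ≠ v →
      inflow g u ≠ inflow g v)
    (hB : ∀ v ∉ ({x₁, x₂, x₃} : Finset V), B ≤ inflow g v)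
    (h₁ : inflow f x₁ < B) (h₂ : inflow f x₂ < B) (h₃ : inflow f x₃ < B)
    (h₁₂ : inflow f x₁ ≠ inflow f x₂) (h₁₃ : inflow f x₁ ≠ inflow f x₃)
    (h₂₃ : inflow f x₂ ≠ inflow f x₃) : AdmitsAntimagicOrientation G := by
  refine h.admitsAntimagicOrientation_of_separated (X := {x₁, x₂, x₃}) (B := B)
    (fun u hu v hv huv => by rw [hout u hu, hout v hv]; exact hinj u hu v hv huv)
    (fun v hv => by rw [hout v hv]; exact hB v hv) ?_ ?_
  · simp only [Finset.mem_insert, Finset.mem_singleton]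
    rintro x (rfl | rfl | rfl) <;> assumption
  · simp only [Finset.mem_insert, Finset.mem_singleton]
    rintro x (rfl | rfl | rfl) x' (rfl | rfl | rfl) h <;>
      first | exact absurd rfl h | assumption | exact Ne.symm (by assumption)

/-- Three centres with a common neighbour. -/
theorem admitsAntimagicOrientation_of_claw {V : Type*} [Fintype V] [DecidableEq V]
    (G : SimpleGraph V) [DecidableRel G.Adj] (hG : G.Connected) (x₁ x₂ x₃ : V) (h12 : x₁ ≠ x₂)
    (h13 : x₁ ≠ x₃) (h23 : x₂ ≠ x₃)
    (hX : ∀ v : V, v ∉ ({x₁, x₂, x₃} : Finset V) →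
      ∃ x ∈ ({x₁, x₂, x₃} : Finset V), G.dist v x ≤ 2)
    (hcard : 2 * (Fintype.card V : ℤ) - 4 ≤ (G.edgeFinset.card : ℤ))
    (y : ℕ → V) (hy : Set.InjOn y (Set.Icc 1 11))
    (hyX : ∀ i ∈ Set.Icc 1 11, y i ∉ ({x₁, x₂, x₃} : Finset V))
    (h₁ : ∀ i ∈ Set.Icc 1 4, G.Adj x₁ (y i)) (h₂ : ∀ i ∈ Set.Icc 4 8, G.Adj x₂ (y i))
    (h₃ : ∀ i ∈ Set.Icc 9 11, G.Adj x₃ (y i)) (h₃₄ : G.Adj x₃ (y 4)) :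
    AdmitsAntimagicOrientation G := by
  have h21 := h12.symm
  have h31 := h13.symm
  have h32 := h23.symm
  have h4 := hyX 4 (by simp)
  simp only [Finset.mem_insert, Finset.mem_singleton, not_or] at h4
  obtain ⟨h41, h42, h43⟩ := h4
  have h14 := Ne.symm h41
  have h24 := Ne.symm h42
  have h34 := Ne.symm h43
  obtain ⟨M, n₁, n₂, f, -, hf, hn, hfT, hl, -, hinj, hB, hx⟩ :=
    exists_labeling_of_dist_le_two G hG {x₁, x₂, x₃} hX 11 y
      (fun i => if i ≤ 4 then x₁ else if i ≤ 8 then x₂ else x₃) hy hyX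
      (by
        rintro i ⟨hi, hi'⟩
        by_cases h : i ≤ 4
        · simp [h, h₁ i ⟨hi, h⟩]
        · by_cases h' : i ≤ 8
          · simp [h, h', h₂ i ⟨by omega, h'⟩]
          · simp [h, h', h₃ i ⟨by omega, hi'⟩])
      -- The negative values direct both special arcs into `y 4`, like its parent arc from `x₁`;
      -- exchanging any two of the three labels keeps the sum at `y 4`.
      {x₂, x₃} (fun _ => y 4) (fun v => if v = x₂ then -1 else -2) 2
      (by simp [(h₂ 4 (by simp)).symm, h₃₄.symm, h42, h43])
      (bijOn_pair_Ioc (by simp) (by simp [h32]))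
      (by
        intro v hv
        refine ⟨Or.inl (Finset.mem_insert_of_mem hv), Or.inr ⟨4, by simp, rfl⟩⟩)
      (by
        intro v hv i hi h
        have hv' : v ≠ x₁ := by
          rintro rfl
          simp [h12, h13] at hv
        rw [Sym2.eq_iff] at h
        have := hyX i hi
        rcases h with ⟨-, h⟩ | ⟨h, h'⟩
        · exact this (by rw [← h]; exact Finset.mem_insert_of_mem hv)
        · rw [← hy (show 4 ∈ Set.Icc 1 11 by simp) hi h] at h'
          simp [hv'] at h')
      (by
        intro v hv
        simp only [Finset.mem_insert, Finset.mem_singleton, not_or] at hv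
        rw [inflow_parentFlow, Finset.sum_filter, Finset.sum_pair h23]
        simp only [Finset.mem_insert, Finset.mem_singleton, hv.2.1, hv.2.2, or_self, if_false]
        split_ifs <;> simp)
  have hs1 := (hx x₁ (by simp) {1, 2, 3, 4} (by decide) (by simp)).1
  have hs2 := (hx x₂ (by simp) {5, 6, 7} (by decide) (by simp)).1
  have hs3 := (hx x₃ (by simp) {9, 10, 11} (by decide) (by simp)).1
  have hl1 := hl 1 (by simp)
  have hl2 := hl 2 (by simp)
  have hl3 := hl 3 (by simp)
  have hl4 := hl 4 (by simp)
  have hl5 := hl 5 (by simp)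
  have hl6 := hl 6 (by simp)
  have hl7 := hl 7 (by simp)
  have hl9 := hl 9 (by simp)
  have hl10 := hl 10 (by simp)
  have hl11 := hl 11 (by simp)
  have hf2 := hfT x₂ (by simp)
  have hf3 := hfT x₃ (by simp)
  rw [hf.anti] at hf2 hf3
  rw [inflow_parentFlow, Finset.sum_filter, Finset.sum_pair h23] at hs1 hs2 hs3
  simp [h12, h13, h23, h32, h41, h42, h43] at hs1 hs2 hs3 hl1 hl2 hl3 hl4
  simp [h32] at hl5 hl6 hl7 hl9 hl10 hl11 hf2 hf3
  have hswap : ∀ a b : V, a ∈ ({x₁, x₂, x₃} : Finset V) → b ∈ ({x₁, x₂, x₃} : Finset V) → a ≠ b →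
      G.Adj a (y 4) → G.Adj b (y 4) → ∃ f', IsSignedLabeling G 0 (M + n₂ + n₁) f' ∧
        (∀ v ∉ ({x₁, x₂, x₃} : Finset V), inflow f' v = inflow f v) ∧
        ∀ w, w ≠ y 4 → inflow f' w = inflow f w + (f b (y 4) - f a (y 4)) *
          ((if w = b then 1 else 0) - (if w = a then 1 else 0)) := by
    intro a b ha hb hab ha4 hb4
    obtain ⟨f', hf', -, -, -, hs⟩ := hf.exists_swap ha4 hb4
      (by rw [Ne, Sym2.eq_iff]; simp [hab, ha4.ne])
    refine ⟨f', hf', fun v hv => ?_, fun w hw => ?_⟩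
    · have hva : v ≠ a := by rintro rfl; exact hv ha
      have hvb : v ≠ b := by rintro rfl; exact hv hb
      simp [hs, hva, hvb]
    · rw [hs, if_neg hw]; ring
  -- From e(G) = M + n₂ + n₁ and |G| = n₁ + n₂ + 3. As n₁ ≥ 1, the label at `y 4` from `x₁` exceeds
  -- 3.
  have hM : (M : ℤ) ≥ n₁ + n₂ + 2 := by
    rw [hf.card_edgeFinset] at hcard
    rw [Finset.card_eq_three.2 ⟨x₁, x₂, x₃, h12, h13, h23, rfl⟩] at hn
    omega
  have h₁₄ := h₁ 4 (by simp)
  have h₂₄ := h₂ 4 (by simp)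
  rcases exists_swap_distinct (inflow f x₁ + f x₁ (y 4)) (inflow f x₂ + 1) (inflow f x₃ + 2)
    (f x₁ (y 4)) (by omega) with h | h | h | h
  · exact hf.admitsAntimagicOrientation_of_triple (fun _ _ => rfl) hinj hB (by omega) (by omega)
      (by omega) (by omega) (by omega) (by omega)
  · obtain ⟨f', hf', hout, hs⟩ := hswap x₁ x₂ (by simp) (by simp) h12 h₁₄ h₂₄
    have e1 := hs x₁ h14
    have e2 := hs x₂ h24
    have e3 := hs x₃ h34
    simp [h12, h21, h31, h32] at e1 e2 e3
    exact hf'.admitsAntimagicOrientation_of_triple hout hinj hB (by omega) (by omega)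
      (by omega) (by omega) (by omega) (by omega)
  · obtain ⟨f', hf', hout, hs⟩ := hswap x₁ x₃ (by simp) (by simp) h13 h₁₄ h₃₄
    have e1 := hs x₁ h14
    have e2 := hs x₂ h24
    have e3 := hs x₃ h34
    simp [h13, h21, h23, h31] at e1 e2 e3
    exact hf'.admitsAntimagicOrientation_of_triple hout hinj hB (by omega) (by omega)
      (by omega) (by omega) (by omega) (by omega)
  · obtain ⟨f', hf', hout, hs⟩ := hswap x₂ x₃ (by simp) (by simp) h23 h₂₄ h₃₄
    have e1 := hs x₁ h14
    have e2 := hs x₂ h24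
    have e3 := hs x₃ h34
    simp [h12, h13, h23, h32] at e1 e2 e3
    exact hf'.admitsAntimagicOrientation_of_triple hout hinj hB (by omega) (by omega)
      (by omega) (by omega) (by omega) (by omega)

/-- Swapping the labels at the two common neighbours `a` and `b` of three centres makes the
vertex-sums of the centres distinct. -/
theorem IsSignedLabeling.admitsAntimagicOrientation_of_path {V : Type*} [Fintype V] [DecidableEq V]
    {G : SimpleGraph V} {m : ℕ} {f : V → V → ℤ} (hf : IsSignedLabeling G 0 m f) {x₁ x₂ x₃ a b : V}
    {B : ℤ} (h12 : x₁ ≠ x₂) (h13 : x₁ ≠ x₃) (h23 : x₂ ≠ x₃)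
    (ha : a ∉ ({x₁, x₂, x₃} : Finset V)) (hb : b ∉ ({x₁, x₂, x₃} : Finset V)) (hab : a ≠ b)
    (h1a : G.Adj x₁ a) (h2a : G.Adj x₂ a) (h2b : G.Adj x₂ b) (h3b : G.Adj x₃ b)
    (hinj : ∀ u ∉ ({x₁, x₂, x₃} : Finset V), ∀ v ∉ ({x₁, x₂, x₃} : Finset V), u ≠ v →
      inflow f u ≠ inflow f v)
    (hB : ∀ v ∉ ({x₁, x₂, x₃} : Finset V), B ≤ inflow f v)
    (hda : f x₂ a < f x₁ a) (hdb : f x₂ b < f x₃ b)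
    (h₁ : inflow f x₁ + (f x₁ a - f x₂ a) < B) (h₂ : inflow f x₂ < B)
    (h₃ : inflow f x₃ + (f x₃ b - f x₂ b) < B)
    (h : (f x₁ a - f x₂ a ≠ f x₃ b - f x₂ b ∧ f x₁ a - f x₂ a ≠ 2 * (f x₃ b - f x₂ b) ∧
        f x₃ b - f x₂ b ≠ 2 * (f x₁ a - f x₂ a)) ∨
      (f x₁ a - f x₂ a = f x₃ b - f x₂ b ∧ inflow f x₁ ≠ inflow f x₃)) :
    AdmitsAntimagicOrientation G := by
  simp only [Finset.mem_insert, Finset.mem_singleton, not_or] at ha hb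
  obtain ⟨ha1, ha2, ha3⟩ := ha
  obtain ⟨hb1, hb2, hb3⟩ := hb
  have h21 := h12.symm
  have h31 := h13.symm
  have h32 := h23.symm
  have h1a' := Ne.symm ha1
  have h2a' := Ne.symm ha2
  have h3a' := Ne.symm ha3
  have h2b' := Ne.symm hb2
  have h3b' := Ne.symm hb3
  -- Nonzero u or w means exchanging the labels at a or at b.
  obtain ⟨u, w, hu, hw, hd12, hd13, hd23⟩ := exists_shift_pair_distinct (inflow f x₁) (inflow f x₂)
    (inflow f x₃) (f x₁ a - f x₂ a) (f x₃ b - f x₂ b) (by omega) (by omega) h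
  -- The values at b are kept, so the second exchange still shifts by the original amount.
  have step₁ : ∃ f', IsSignedLabeling G 0 m f' ∧ f' x₂ b = f x₂ b ∧ f' x₃ b = f x₃ b ∧
      (∀ v ∉ ({x₁, x₂, x₃} : Finset V), inflow f' v = inflow f v) ∧
      inflow f' x₁ = inflow f x₁ + u ∧ inflow f' x₂ = inflow f x₂ - u ∧
      inflow f' x₃ = inflow f x₃ := by
    rcases hu with rfl | rfl
    · exact ⟨f, hf, rfl, rfl, fun _ _ => rfl, by simp, by simp, rfl⟩
    · obtain ⟨f', hf', hsame, -, -, hs⟩ := hf.exists_swap h1a h2a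
        (by rw [Ne, Sym2.eq_iff]; simp [h12, h1a'])
      refine ⟨f', hf', ?_, ?_, fun v hv => ?_, ?_, ?_, ?_⟩
      · apply hsame <;> rw [Ne, Sym2.eq_iff] <;> simp [h21, hab.symm, h2a']
      · apply hsame <;> rw [Ne, Sym2.eq_iff] <;> simp [h31, h32, h3a']
      · simp only [Finset.mem_insert, Finset.mem_singleton, not_or] at hv
        simp [hs, hv.1, hv.2]
      · rw [hs]; simp [h12, h1a']
      · rw [hs]; simp [h21, h2a']; ring
      · rw [hs]; simp [h31, h32]
  obtain ⟨f', hf', hv2, hv3, hout, hi1, hi2, hi3⟩ := step₁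
  have step₂ : ∃ f'', IsSignedLabeling G 0 m f'' ∧
      (∀ v ∉ ({x₁, x₂, x₃} : Finset V), inflow f'' v = inflow f v) ∧
      inflow f'' x₁ = inflow f x₁ + u ∧ inflow f'' x₂ = inflow f x₂ - u - w ∧
      inflow f'' x₃ = inflow f x₃ + w := by
    rcases hw with rfl | rfl
    · exact ⟨f', hf', hout, hi1, by rw [hi2, sub_zero], by rw [hi3, add_zero]⟩
    · obtain ⟨f'', hf'', -, -, -, hs⟩ := hf'.exists_swap h3b h2b
        (by rw [Ne, Sym2.eq_iff]; simp [h32, h3b'])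
      refine ⟨f'', hf'', fun v hv => ?_, ?_, ?_, ?_⟩
      · rw [← hout v hv]
        simp only [Finset.mem_insert, Finset.mem_singleton, not_or] at hv
        simp [hs, hv.2]
      · rw [hs, hi1]; simp [h12, h13]
      · rw [hs, hi2, hv2, hv3]; simp [h23, h2b']; ring
      · rw [hs, hi3, hv2, hv3]; simp [h32, h3b']
  obtain ⟨f'', hf'', hout', hj1, hj2, hj3⟩ := step₂
  exact hf''.admitsAntimagicOrientation_of_triple hout' hinj hB (by omega) (by omega) (by omega)
    (by omega) (by omega) (by omega)

/-- Three centres, the second of which has a common neighbour with each of the others. -/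
theorem admitsAntimagicOrientation_of_chain {V : Type*} [Fintype V] [DecidableEq V]
    (G : SimpleGraph V) [DecidableRel G.Adj] (hG : G.Connected) (x₁ x₂ x₃ : V) (h12 : x₁ ≠ x₂)
    (h13 : x₁ ≠ x₃) (h23 : x₂ ≠ x₃)
    (hX : ∀ v : V, v ∉ ({x₁, x₂, x₃} : Finset V) →
      ∃ x ∈ ({x₁, x₂, x₃} : Finset V), G.dist v x ≤ 2)
    (hcard : 2 * (Fintype.card V : ℤ) - 4 ≤ (G.edgeFinset.card : ℤ))
    (y : ℕ → V) (hy : Set.InjOn y (Set.Icc 1 11))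
    (hyX : ∀ i ∈ Set.Icc 1 11, y i ∉ ({x₁, x₂, x₃} : Finset V))
    (h₁ : ∀ i ∈ Set.Icc 1 4, G.Adj x₁ (y i)) (h₂ : ∀ i ∈ Set.Icc 4 8, G.Adj x₂ (y i))
    (h₃ : ∀ i ∈ Set.Icc 8 11, G.Adj x₃ (y i)) :
    AdmitsAntimagicOrientation G := by
  have h21 := h12.symm
  have h31 := h13.symm
  have h32 := h23.symm
  have h4X := hyX 4 (by simp)
  have h8X := hyX 8 (by simp)
  have h4 := h4X
  have h8 := h8X
  simp only [Finset.mem_insert, Finset.mem_singleton, not_or] at h4 h8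
  obtain ⟨h41, h42, h43⟩ := h4
  obtain ⟨h81, h82, h83⟩ := h8
  have h14 := Ne.symm h41
  have h24 := Ne.symm h42
  have h34 := Ne.symm h43
  have h18 := Ne.symm h81
  have h28 := Ne.symm h82
  have h38 := Ne.symm h83
  have h48 : y 4 ≠ y 8 := fun h => by
    have := hy (show 4 ∈ Set.Icc 1 11 by simp) (show 8 ∈ Set.Icc 1 11 by simp) h
    omega
  have h84 := h48.symm
  obtain ⟨M, n₁, n₂, f, -, hf, hn, hfT, hl, hcons, hinj, hB, hx⟩ :=
    exists_labeling_of_dist_le_two G hG {x₁, x₂, x₃} hX 11 y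
      (fun i => if i ≤ 4 then x₁ else if i ≤ 7 then x₂ else x₃) hy hyX
      (by
        rintro i ⟨hi, hi'⟩
        by_cases h : i ≤ 4
        · simp [h, h₁ i ⟨hi, h⟩]
        · by_cases h' : i ≤ 7
          · simp [h, h', h₂ i ⟨by omega, by omega⟩]
          · simp [h, h', h₃ i ⟨by omega, hi'⟩])
      -- The arcs from `x₂` to `y 4` and `y 8` have labels 1 and 2; the parent arcs there come from
      -- `x₁` and `x₃`.
      {y 4, y 8} (fun _ => x₂) (fun v => if v = y 4 then 1 else 2) 2
      (by simp [h₂ 4 (by simp), h₂ 8 (by simp), h24, h28])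
      (bijOn_pair_Ioc (by simp) (by simp [h84]))
      (by
        intro v hv
        rw [Finset.mem_insert, Finset.mem_singleton] at hv
        refine ⟨Or.inr ?_, by simp⟩
        rcases hv with rfl | rfl
        exacts [⟨4, by simp, rfl⟩, ⟨8, by simp, rfl⟩])
      (by
        intro v hv i hi h
        rw [Finset.mem_insert, Finset.mem_singleton] at hv
        rw [Sym2.eq_iff] at h
        have := hyX i hi
        rcases h with ⟨h, h'⟩ | ⟨h, -⟩
        · rcases hv with rfl | rfl
          · rw [← hy (show 4 ∈ Set.Icc 1 11 by simp) hi h'] at h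
            simp [h21] at h
          · rw [← hy (show 8 ∈ Set.Icc 1 11 by simp) hi h'] at h
            simp [h23] at h
        · simp [← h] at this)
      (by
        intro v hv
        simp only [Finset.mem_insert, Finset.mem_singleton, not_or] at hv
        rw [inflow_parentFlow, Finset.sum_filter, Finset.sum_pair h48]
        simp only [Ne.symm hv.2.1, if_false]
        split_ifs <;> simp)
  have hs1 := (hx x₁ (by simp) {1, 2, 3, 4} (by decide) (by simp)).1
  have hs2 := (hx x₂ (by simp) {5, 6, 7} (by decide) (by simp)).1
  have hs3 := (hx x₃ (by simp) {8, 9, 10, 11} (by decide) (by simp)).1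
  have hl1 := hl 1 (by simp)
  have hl2 := hl 2 (by simp)
  have hl3 := hl 3 (by simp)
  have hl4 := hl 4 (by simp)
  have hl5 := hl 5 (by simp)
  have hl6 := hl 6 (by simp)
  have hl7 := hl 7 (by simp)
  have hl8 := hl 8 (by simp)
  have hl9 := hl 9 (by simp)
  have hl10 := hl 10 (by simp)
  have hl11 := hl 11 (by simp)
  have hf4 := hfT (y 4) (by simp)
  have hf8 := hfT (y 8) (by simp)
  have hc48 := hcons 4 (by simp) 8 (by simp)
  rw [inflow_parentFlow, Finset.sum_filter, Finset.sum_pair h48] at hs1 hs2 hs3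
  simp [h23, h21, h84, h14, h24, h34, h18, h28, h38] at hs1 hs2 hs3
  simp [h84] at hl1 hl2 hl3 hl4 hl5 hl6 hl7 hl8 hl9 hl10 hl11 hf4 hf8
  simp only [show (4 : ℕ) ≤ 4 from le_rfl, show ¬ (8 : ℕ) ≤ 4 by decide,
    show ¬ (8 : ℕ) ≤ 7 by decide, if_true, if_false] at hc48
  have hM : (M : ℤ) ≥ n₁ + n₂ + 2 := by
    rw [hf.card_edgeFinset] at hcard
    rw [Finset.card_eq_three.2 ⟨x₁, x₂, x₃, h12, h13, h23, rfl⟩] at hn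
    omega
  have h₁₄ := h₁ 4 (by simp)
  have h₂₄ := h₂ 4 (by simp)
  have h₂₈ := h₂ 8 (by simp)
  have h₃₈ := h₃ 8 (by simp)
  -- By `hM` neither shift is twice the other, so this is the only obstruction to two independent
  -- exchanges.
  by_cases hδ : f x₁ (y 4) - 1 = f x₃ (y 8) - 2 ∧ inflow f x₁ = inflow f x₃
  · obtain ⟨hδ, hs13⟩ := hδ
    obtain ⟨hlt, hgap⟩ := hc48 (by omega)
    -- Exchanging the labels 1 and 2 at `x₂` makes the shifts differ by 2, at the cost of moving the
    -- sums of `y 4` and `y 8` towards each other by 1 each.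
    obtain ⟨f', hf', hsame, hv4, hv8, hs⟩ := hf.exists_swap h₂₄ h₂₈
      (by rw [Ne, Sym2.eq_iff]; simp [h48, h28])
    have hv4' : f' x₁ (y 4) = f x₁ (y 4) := by
      apply hsame <;> rw [Ne, Sym2.eq_iff] <;> simp [h12, h14, h18]
    have hv8' : f' x₃ (y 8) = f x₃ (y 8) := by
      apply hsame <;> rw [Ne, Sym2.eq_iff] <;> simp [h32, h34, h38]
    have hrest : ∀ v, v ≠ y 4 → v ≠ y 8 → inflow f' v = inflow f v := by
      intro v h h'
      rw [hs]; simp [h, h']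
    have e4 : inflow f' (y 4) = inflow f (y 4) + 1 := by
      rw [hs]; simp [h42, h48, hf4, hf8]
    have e8 : inflow f' (y 8) = inflow f (y 8) - 1 := by
      rw [hs]; simp [h82, h84, hf4, hf8]; ring
    have hB4 := hB _ h4X
    have hB8 := hB _ h8X
    -- The perturbed sums of `y 4` and `y 8` coincide exactly when their gap was 2.
    by_cases hgap2 : inflow f (y 8) = inflow f (y 4) + 2
    · obtain ⟨g, hg, hsame', hw4, hw8, ht⟩ := hf'.exists_swap h₁₄ h₃₈
        (by rw [Ne, Sym2.eq_iff]; simp [h13, h18])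
      have hw4' : g x₂ (y 4) = f' x₂ (y 4) := by
        apply hsame' <;> rw [Ne, Sym2.eq_iff] <;> simp [h21, h23, h24, h28]
      have hw8' : g x₂ (y 8) = f' x₂ (y 8) := by
        apply hsame' <;> rw [Ne, Sym2.eq_iff] <;> simp [h21, h23, h24, h28]
      have hrest' : ∀ v, v ≠ y 4 → v ≠ y 8 → v ≠ x₁ → v ≠ x₃ → inflow g v = inflow f v := by
        intro v h h' h1 h3
        rw [ht, hrest v h h']; simp [h, h', h1, h3]
      have g4 : inflow g (y 4) = inflow f (y 8) := by
        rw [ht, e4, hgap2, hv4', hv8']; simp [h41, h43, h48]; omega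
      have g8 : inflow g (y 8) = inflow f (y 4) := by
        rw [ht, e8, hgap2, hv4', hv8']; simp [h81, h83, h84]; omega
      have g1 : inflow g x₁ = inflow f x₁ - 1 := by
        rw [ht, hrest x₁ h14 h18, hv4', hv8']; simp [h14, h18, h13]; omega
      have g3 : inflow g x₃ = inflow f x₃ + 1 := by
        rw [ht, hrest x₃ h34 h38, hv4', hv8']; simp [h34, h38, h31]; omega
      have g2 : inflow g x₂ = inflow f x₂ := hrest' x₂ h24 h28 h21 h23
      have hperm : ∀ v ∉ ({x₁, x₂, x₃} : Finset V),
          inflow g v = inflow f (Equiv.swap (y 4) (y 8) v) := by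
        intro v hv
        by_cases hv4 : v = y 4
        · rw [hv4, Equiv.swap_apply_left, g4]
        by_cases hv8 : v = y 8
        · rw [hv8, Equiv.swap_apply_right, g8]
        rw [Equiv.swap_apply_of_ne_of_ne hv4 hv8]
        simp only [Finset.mem_insert, Finset.mem_singleton, not_or] at hv
        exact hrest' v hv4 hv8 hv.1 hv.2.2
      have hpermX : ∀ v ∉ ({x₁, x₂, x₃} : Finset V),
          Equiv.swap (y 4) (y 8) v ∉ ({x₁, x₂, x₃} : Finset V) := by
        intro v hv
        by_cases hv4 : v = y 4
        · rwa [hv4, Equiv.swap_apply_left]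
        by_cases hv8 : v = y 8
        · rwa [hv8, Equiv.swap_apply_right]
        rwa [Equiv.swap_apply_of_ne_of_ne hv4 hv8]
      exact hg.admitsAntimagicOrientation_of_path (B := -(2 * (M : ℤ) + n₂)) h12 h13 h23 h4X h8X h48
        h₁₄ h₂₄ h₂₈ h₃₈
        (fun u hu v hv huv => by
          rw [hperm u hu, hperm v hv]
          exact hinj _ (hpermX u hu) _ (hpermX v hv) fun h => huv (Equiv.injective _ h))
        (fun v hv => by rw [hperm v hv]; exact hB _ (hpermX v hv))
        (by omega) (by omega) (by omega) (by omega) (by omega) (by omega)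
    · refine hf'.admitsAntimagicOrientation_of_path (B := -(2 * (M : ℤ) + n₂)) h12 h13 h23 h4X h8X h48
        h₁₄ h₂₄ h₂₈ h₃₈ ?_ ?_ (by omega) (by omega) ?_ ?_ ?_ (by omega)
      -- The new sums of `y 4` and `y 8` stay between their old ones, where no other vertex outside
      -- `X` has its sum.
      · have haux : ∀ v ∉ ({x₁, x₂, x₃} : Finset V), v ≠ y 4 → v ≠ y 8 →
            inflow f' v ≠ inflow f' (y 4) ∧ inflow f' v ≠ inflow f' (y 8) := by
          intro v hv hv4 hv8
          rw [hrest v hv4 hv8, e4, e8]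
          have := hgap v hv hv4 hv8
          omega
        intro u hu v hv huv
        by_cases hu4 : u = y 4
        · by_cases hv8 : v = y 8
          · rw [hu4, hv8]; omega
          · rw [hu4]
            exact (haux v hv (fun h => huv (hu4.trans h.symm)) hv8).1.symm
        by_cases hu8 : u = y 8
        · by_cases hv4 : v = y 4
          · rw [hu8, hv4]; omega
          · rw [hu8]
            exact (haux v hv hv4 (fun h => huv (hu8.trans h.symm))).2.symm
        by_cases hv4 : v = y 4
        · rw [hv4]; exact (haux u hu hu4 hu8).1
        by_cases hv8 : v = y 8
        · rw [hv8]; exact (haux u hu hu4 hu8).2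
        rw [hrest u hu4 hu8, hrest v hv4 hv8]
        exact hinj u hu v hv huv
      · intro v hv
        by_cases hv4 : v = y 4
        · rw [hv4]; omega
        by_cases hv8 : v = y 8
        · rw [hv8]; omega
        rw [hrest v hv4 hv8]; exact hB v hv
      · rw [hrest x₁ h14 h18]; omega
      · rw [hrest x₂ h24 h28]; omega
      · rw [hrest x₃ h34 h38]; omega
  · exact hf.admitsAntimagicOrientation_of_path (B := -(2 * (M : ℤ) + n₂)) h12 h13 h23 h4X h8X h48
      h₁₄ h₂₄ h₂₈ h₃₈ hinj hB (by omega) (by omega) (by omega) (by omega) (by omega) (by omega)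

theorem theorem1p6 {V : Type*} [Fintype V] [DecidableEq V]
    (G : SimpleGraph V) [DecidableRel G.Adj] (hG : G.Connected)
    (X : Finset V)
    (hX : ∀ v : V, v ∉ X → ∃ x ∈ X, G.dist v x ≤ 2)
    (h :
      (∃ x₁ : V, X = {x₁} ∧ 2 ≤ G.degree x₁) ∨
      (∃ x₁ x₂ : V, x₁ ≠ x₂ ∧ X = {x₁, x₂} ∧
        (2 * (Fintype.card V : ℤ) - 5 ≤ (G.edgeFinset.card : ℤ)) ∧
        ∃ y : ℕ → V, Set.InjOn y (Set.Icc 1 7) ∧ (∀ i ∈ Set.Icc 1 7, y i ∉ X) ∧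
          (IsCompleteTo G x₁ {y 1, y 2, y 3, x₂} ∨ IsCompleteTo G x₁ {y 1, y 2, y 3, y 4}) ∧
          IsCompleteTo G x₂ {y 4, y 5, y 6, y 7}) ∨
      (∃ x₁ x₂ x₃ : V, x₁ ≠ x₂ ∧ x₁ ≠ x₃ ∧ x₂ ≠ x₃ ∧ X = {x₁, x₂, x₃} ∧
        (2 * (Fintype.card V : ℤ) - 4 ≤ (G.edgeFinset.card : ℤ)) ∧
        ∃ y : ℕ → V, Set.InjOn y (Set.Icc 1 11) ∧ (∀ i ∈ Set.Icc 1 11, y i ∉ X) ∧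
          IsCompleteTo G x₁ {y 1, y 2, y 3, y 4} ∧
          IsCompleteTo G x₂ {y 4, y 5, y 6, y 7, y 8} ∧
          (IsCompleteTo G x₃ {y 4, y 9, y 10, y 11} ∨
            IsCompleteTo G x₃ {y 8, y 9, y 10, y 11}))) :
    AdmitsAntimagicOrientation G := by
  rcases h with ⟨x, rfl, hdeg⟩ | ⟨x₁, x₂, hne, rfl, -, y, hy, hyX, h₁, h₂⟩ |
    ⟨x₁, x₂, x₃, h12, h13, h23, rfl, hcard, y, hy, hyX, h₁, h₂, h₃⟩
  · exact admitsAntimagicOrientation_of_singleton G hG x hX hdeg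
  · have h₂' : ∀ i ∈ Set.Icc 4 7, G.Adj x₂ (y i) := by
      rintro i ⟨hi, hi'⟩
      interval_cases i <;> exact h₂ _ (by simp)
    rcases h₁ with h₁ | h₁
    · exact admitsAntimagicOrientation_of_adjacent_pair G hG x₁ x₂ hX y hy hyX (h₁ _ (by simp))
        (by rintro i ⟨hi, hi'⟩; interval_cases i <;> exact h₁ _ (by simp)) h₂'
    · exact admitsAntimagicOrientation_of_pair G hG x₁ x₂ hne hX y hy hyX
        (by rintro i ⟨hi, hi'⟩; interval_cases i <;> exact h₁ _ (by simp)) h₂'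
  · have h₁' : ∀ i ∈ Set.Icc 1 4, G.Adj x₁ (y i) := by
      rintro i ⟨hi, hi'⟩
      interval_cases i <;> exact h₁ _ (by simp)
    have h₂' : ∀ i ∈ Set.Icc 4 8, G.Adj x₂ (y i) := by
      rintro i ⟨hi, hi'⟩
      interval_cases i <;> exact h₂ _ (by simp)
    rcases h₃ with h₃ | h₃
    · exact admitsAntimagicOrientation_of_claw G hG x₁ x₂ x₃ h12 h13 h23 hX hcard y hy hyX h₁' h₂'
        (by rintro i ⟨hi, hi'⟩; interval_cases i <;> exact h₃ _ (by simp)) (h₃ _ (by simp))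
    · exact admitsAntimagicOrientation_of_chain G hG x₁ x₂ x₃ h12 h13 h23 hX hcard y hy hyX h₁' h₂'
        (by rintro i ⟨hi, hi'⟩; interval_cases i <;> exact h₃ _ (by simp))
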